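/- For a real random variable $Y$ define the Poincaré constant $$R_Y=\sup_{g}\frac{\operatorname{Var} g(Y)}{\mathbb E\, g'(Y)^2}\in[0,\infty],$$ the supremum over all locally absolutely continuous $g:\mathbb R\to\mathbb R$ with $\operatorname{Var} g(Y)\in(0,\infty]$ and $\mathbb E\,g'(Y)^2<\infty$ (a quotient with denominator $0$ counts as $\infty$). If $Y$ has a nonnegative locally absolutely continuous density $p$, its Fisher information is $I(Y)=\mathbb E\big[(p'(Y)/p(Y))^2\big]$; otherwise $I(Y)=\infty$. (a) For all real $I,R\ge 0$ there is a constant $C$, depending only on $I$ and $R$, such that the following holds. Let $X_1,X_2,\dots$ be IID real random variables with $I(X_1)=I$ and $R_{X_1}=R$, let $\sigma^2=\operatorname{Var}(X_1)$, and let $U_n=(X_1+\dots+X_n)/\sqrt{n\sigma^2}$. Then, for every $n\ge 1$, $R_{U_n}$ is finite and $$R_{U_n}-1\le \frac Cn .$$ (b) The rate $1/n$ is optimal up to the constant: there exist IID random variables $X_1,X_2,\dots$ with a $C^\infty$ density and with $I(X_1)<\infty$ and $R_{X_1}<\infty$, and a constant $c>0$, such that $R_{U_n}-1\ge c/n$ for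 every $n\ge1$. -/

import Mathlib

open MeasureTheory ProbabilityTheory
open scoped ENNReal NNReal

/-- A function on the real line is (locally) absolutely continuous if it is absolutely
continuous on every compact interval. -/
def IsAbsCont (g : ℝ → ℝ) : Prop :=
  ∀ a b : ℝ, AbsolutelyContinuousOnInterval g a b

/-- The class `H₁(Y)` for a random variable `Y` with law `ν`: absolutely continuous functions
`g` on the real line with `Var g(Y) > 0` and `E g'(Y)² < ∞`. The extended variance `evariance`
is `∞` exactly when `g(Y)` is not square integrable. -/
def classH1 (ν : Measure ℝ) : Set (ℝ → ℝ) :=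
  {g | IsAbsCont g ∧ 0 < evariance g ν ∧ ∫⁻ y, ENNReal.ofReal ((deriv g y) ^ 2) ∂ν < ∞}

/-- The Poincaré constant `R_Y = sup Var g(Y) / E g'(Y)²`, the supremum over `g ∈ H₁(Y)`, of a
random variable `Y` with law `ν`, as an extended nonnegative number. (A quotient with positive
numerator and zero denominator is `∞` in `ℝ≥0∞`.) -/
noncomputable def poincareConst (ν : Measure ℝ) : ℝ≥0∞ :=
  ⨆ g ∈ classH1 ν, evariance g ν / ∫⁻ y, ENNReal.ofReal ((deriv g y) ^ 2) ∂ν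

/-- `p` is a nonnegative, locally absolutely continuous density of `ν` with respect to Lebesgue
measure. In particular every nonnegative continuously differentiable density is one. Such a `p`
is unique if it exists. -/
structure IsRegularDensity (ν : Measure ℝ) (p : ℝ → ℝ) : Prop where
  nonneg : ∀ x, 0 ≤ p x
  absCont : IsAbsCont p
  eq_withDensity : ν = volume.withDensity (fun x => ENNReal.ofReal (p x))

/-- The Fisher information `I(Y) = E ρ(Y)²`, where `ρ = p' / p` is the score function of the
regular density `p` of `Y`; it is `∞` if the law `ν` of `Y` has no regular density. (The infimum
is over at most one `p`.) -/
noncomputable def fisherInfo (ν : Measure ℝ) : ℝ≥0∞ :=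
  ⨅ (p : ℝ → ℝ) (_ : IsRegularDensity ν p), ∫⁻ y, ENNReal.ofReal ((deriv p y / p y) ^ 2) ∂ν

/-- The normalised sum `U_n = (X_1 + ⋯ + X_n) / √(n σ²)`, with `σ²` the common variance; the
sequence is indexed from `0`. -/
noncomputable def normalizedSum {Ω : Type*} [MeasurableSpace Ω] (P : Measure Ω)
    (X : ℕ → Ω → ℝ) (n : ℕ) (ω : Ω) : ℝ :=
  (∑ i ∈ Finset.range n, X i ω) / √(n * variance (X 0) P)

/-- `X 0, X 1, …` are independent and identically distributed random variables under `P`. -/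
structure IsIID {Ω : Type*} [MeasurableSpace Ω] (P : Measure Ω) (X : ℕ → Ω → ℝ) : Prop where
  measurable : ∀ i, Measurable (X i)
  indep : iIndepFun X P
  identDistrib : ∀ i, IdentDistrib (X i) (X 0) P P

/-!
The proof of the upper bound works with the Poincaré inequality tested on primitives `∫_0^x h` of
bounded measurable `h` (`PoincareIneq`). This class is stable under convolution, since averaging
the primitive of `h` over an independent summand gives a primitive of the averaged `h`. It yields
the same constant for all absolutely continuous test functions, by truncating the derivative and
Fatou's lemma (`poincareConst_le_of_poincareIneq`); the converse, for laws absolutely continuous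
with respect to Lebesgue measure, is Lebesgue differentiation
(`poincareIneq_of_poincareConst_le`).

Write `s²` for the variance of `X`, `R = ρ s²` for its Poincaré constant and `c n` for that of
`S_n = X_1 + ⋯ + X_n`. The Hoeffding decomposition of `g(S + S')` for independent `S`, `S'`
(`variance_prod_eq`) gives three facts. The constants `c n` are subadditive. The covariance of
`S_n` with `g(S_n)`, when `E g'(S_n) = 0`, is at most `√(n s² R)` times the `L²` norm of `g'(S_n)`,
because the squared bound is additive over independent summands (`CovIneq.conv`). And for two
independent copies, when `E g'(S + S') = 0`, each main effect of `g'` carries at most half of its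
squared norm, so that the Poincaré inequality holds with `3/2` in place of the factor `2` of
subadditivity (`PoincareIneq.variance_conv_self_le`). Splitting off the linear part of a test
function, which contributes exactly the variance, these facts combine to
`c (2m) ≤ max (2m s² + 16 R) (3/2 c m + m s²/8)`. An elementary lemma on sequences
(`exists_bound_of_subadditive_of_doubling`) then gives `c n ≤ (n + C) s²` with `C` depending on `ρ`
only. The Fisher information enters through a lower bound for `s²` alone: it bounds the density, so
the law cannot concentrate (`IsRegularDensity.one_le_mul_variance`).

For the optimality of the rate, take a centred `X` with nonzero third moment. The third moment `τ`
of `U_n` has order `n^{-1/2}`, and the test function `x + (τ/4) x²` shows that the Poincaré constant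
of `U_n` exceeds `1` by order `τ²` (`le_poincareConst_of_third_moment`). A skewed mixture of two
Gaussians is such a law; its Poincaré constant is finite by a weighted Cauchy–Schwarz argument
(`exists_poincareIneq_of_density`).
-/

/-! ### Two independent variables -/

/-- At most linear growth of a function on the plane. With second moments it puts `f` and all
its sections and partial averages in `L²`, with no exceptional null sets. -/
def LinearGrowth (f : ℝ × ℝ → ℝ) : Prop :=
  ∃ M, ∀ z, |f z| ≤ M * (1 + |z.1| + |z.2|)

theorem memLp_two_of_affine_bound {μ : Measure ℝ} [IsProbabilityMeasure μ] (hμ : MemLp id 2 μ)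
    {g : ℝ → ℝ} (hg : Measurable g) {a b : ℝ} (h : ∀ x, |g x| ≤ a + b * |x|) : MemLp g 2 μ := by
  refine MemLp.mono (g := fun x => a + b * |x|) ?_ hg.aestronglyMeasurable
    (Filter.Eventually.of_forall fun x => ?_)
  · exact (memLp_const a).add (hμ.norm.const_mul b)
  · exact (h x).trans (le_abs_self _)

section TwoVariables

variable {μ ν : Measure ℝ} [IsProbabilityMeasure μ] [IsProbabilityMeasure ν]

theorem LinearGrowth.memLp {f : ℝ × ℝ → ℝ} (hf : LinearGrowth f) (hm : Measurable f)
    (hμ : MemLp id 2 μ) (hν : MemLp id 2 ν) : MemLp f 2 (μ.prod ν) := by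
  obtain ⟨M, hM⟩ := hf
  have h1 : MemLp (fun z : ℝ × ℝ => |z.1|) 2 (μ.prod ν) := hμ.norm.comp_fst ν
  have h2 : MemLp (fun z : ℝ × ℝ => |z.2|) 2 (μ.prod ν) := hν.norm.comp_snd μ
  have h3 : MemLp (fun z : ℝ × ℝ => M * (1 + |z.1| + |z.2|)) 2 (μ.prod ν) :=
    (((memLp_const (1 : ℝ)).add h1).add h2).const_mul M
  exact h3.mono hm.aestronglyMeasurable
    (Filter.Eventually.of_forall fun x => (hM x).trans (le_abs_self _))

theorem LinearGrowth.memLp_section_left {f : ℝ × ℝ → ℝ} (hf : LinearGrowth f)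
    (hm : Measurable f) (hμ : MemLp id 2 μ) (y : ℝ) : MemLp (fun x => f (x, y)) 2 μ := by
  obtain ⟨M, hM⟩ := hf
  refine memLp_two_of_affine_bound hμ (by fun_prop) (a := M * (1 + |y|)) (b := M) fun x => ?_
  have := hM (x, y)
  simp only at this
  linarith

theorem LinearGrowth.swap {f : ℝ × ℝ → ℝ} (hf : LinearGrowth f) :
    LinearGrowth (fun z => f (z.2, z.1)) := by
  obtain ⟨M, hM⟩ := hf
  exact ⟨M, fun z => (hM (z.2, z.1)).trans_eq (by ring)⟩

theorem LinearGrowth.memLp_section_right {f : ℝ × ℝ → ℝ} (hf : LinearGrowth f)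
    (hm : Measurable f) (hν : MemLp id 2 ν) (x : ℝ) : MemLp (fun y => f (x, y)) 2 ν :=
  hf.swap.memLp_section_left (by fun_prop) hν x

theorem LinearGrowth.abs_average_le {f : ℝ × ℝ → ℝ} (hf : LinearGrowth f)
    (hν : MemLp id 2 ν) : ∃ a b, ∀ x, |∫ y, f (x, y) ∂ν| ≤ a + b * |x| := by
  obtain ⟨M, hM⟩ := hf
  have hi : Integrable (fun y : ℝ => |y|) ν := (hν.integrable one_le_two).abs
  refine ⟨M * (1 + ∫ y, |y| ∂ν), M, fun x => ?_⟩
  calc |∫ y, f (x, y) ∂ν| ≤ ∫ y, M * (1 + |x| + |y|) ∂ν := by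
        refine norm_integral_le_of_norm_le (f := fun y => f (x, y)) ?_
          (Filter.Eventually.of_forall fun y => hM (x, y))
        exact ((integrable_const _).add hi).const_mul M
    _ = _ := by
        rw [integral_const_mul, integral_add (integrable_const _) hi]
        simp
        ring

theorem measurable_average {f : ℝ × ℝ → ℝ} (hm : Measurable f) :
    Measurable (fun x => ∫ y, f (x, y) ∂ν) :=
  (hm.stronglyMeasurable.integral_prod_right' (ν := ν)).measurable

theorem LinearGrowth.memLp_average {f : ℝ × ℝ → ℝ} (hf : LinearGrowth f)
    (hm : Measurable f) (hμ : MemLp id 2 μ) (hν : MemLp id 2 ν) :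
    MemLp (fun x => ∫ y, f (x, y) ∂ν) 2 μ := by
  obtain ⟨a, b, h⟩ := hf.abs_average_le hν
  exact memLp_two_of_affine_bound hμ (measurable_average hm) h

theorem LinearGrowth.memLp_average' {f : ℝ × ℝ → ℝ} (hf : LinearGrowth f)
    (hm : Measurable f) (hμ : MemLp id 2 μ) (hν : MemLp id 2 ν) :
    MemLp (fun y => ∫ x, f (x, y) ∂μ) 2 ν :=
  hf.swap.memLp_average (by fun_prop) hν hμ

/-- The Hoeffding (ANOVA) decomposition of the variance: two main effects, plus the interaction,
which is written as the mean over `y` of the variance in `x` of the function minus its first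
main effect. -/
theorem variance_prod_eq {f : ℝ × ℝ → ℝ} (hf : LinearGrowth f) (hm : Measurable f)
    (hμ : MemLp id 2 μ) (hν : MemLp id 2 ν) :
    Var[f; μ.prod ν] = Var[fun x => ∫ y, f (x, y) ∂ν; μ] + Var[fun y => ∫ x, f (x, y) ∂μ; ν]
      + ∫ y, Var[fun x => f (x, y) - ∫ y', f (x, y') ∂ν; μ] ∂ν := by
  set A : ℝ → ℝ := fun x => ∫ y, f (x, y) ∂ν with hA
  set B : ℝ → ℝ := fun y => ∫ x, f (x, y) ∂μ with hB
  have hf2 := hf.memLp hm hμ hν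
  have hA2 : MemLp A 2 μ := hf.memLp_average hm hμ hν
  have hB2 : MemLp B 2 ν := hf.memLp_average' hm hμ hν
  have hfi : Integrable f (μ.prod ν) := hf2.integrable one_le_two
  have hD2 : MemLp (fun z : ℝ × ℝ => f z - A z.1) 2 (μ.prod ν) := hf2.sub (hA2.comp_fst ν)
  have hmA : ∫ x, A x ∂μ = ∫ z, f z ∂(μ.prod ν) := (integral_prod f hfi).symm
  have hmB : ∫ y, B y ∂ν = ∫ z, f z ∂(μ.prod ν) := (integral_prod_symm f hfi).symm
  have hsec : ∀ y, Var[fun x => f (x, y) - A x; μ]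
      = (∫ x, (f (x, y) - A x) ^ 2 ∂μ) - (B y - ∫ z, f z ∂(μ.prod ν)) ^ 2 := fun y => by
    have h1 := hf.memLp_section_left hm hμ y
    refine (variance_eq_sub (h1.sub hA2)).trans ?_
    simp only [Pi.pow_apply, Pi.sub_apply]
    rw [integral_sub (h1.integrable one_le_two) (hA2.integrable one_le_two), hmA]
  have hI1 : Integrable (fun y => ∫ x, (f (x, y) - A x) ^ 2 ∂μ) ν :=
    hD2.integrable_sq.integral_prod_right
  have hI2 : Integrable (fun y => (B y - ∫ z, f z ∂(μ.prod ν)) ^ 2) ν :=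
    (hB2.sub (memLp_const _)).integrable_sq
  have hvB : ∫ y, (B y - ∫ z, f z ∂(μ.prod ν)) ^ 2 ∂ν = Var[B; ν] := by
    rw [variance_eq_integral hB2.aemeasurable, hmB]
  have hinner : ∀ x, ∫ y, (f (x, y) - A x) ^ 2 ∂ν = (∫ y, f (x, y) ^ 2 ∂ν) - A x ^ 2 := fun x => by
    have h1 := hf.memLp_section_right hm hν x
    have h2 := variance_eq_sub h1
    rw [variance_eq_integral h1.aemeasurable] at h2
    exact h2
  have hswap : ∫ y, ∫ x, (f (x, y) - A x) ^ 2 ∂μ ∂ν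
      = (∫ z, f z ^ 2 ∂(μ.prod ν)) - ∫ x, A x ^ 2 ∂μ := by
    rw [← integral_prod_symm (fun z : ℝ × ℝ => (f z - A z.1) ^ 2) hD2.integrable_sq,
      integral_prod _ hD2.integrable_sq]
    simp only [hinner]
    rw [integral_sub hf2.integrable_sq.integral_prod_left hA2.integrable_sq,
      ← integral_prod _ hf2.integrable_sq]
  rw [integral_congr_ae (Filter.Eventually.of_forall hsec), integral_sub hI1 hI2, hswap, hvB,
    variance_eq_sub hf2, variance_eq_sub hA2]
  simp only [Pi.pow_apply, hmA]
  ring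

/-- The covariance with a sum of independent variables is carried by the main effects. -/
theorem covariance_add_prod {f : ℝ × ℝ → ℝ} (hf : LinearGrowth f) (hm : Measurable f)
    (hμ : MemLp id 2 μ) (hν : MemLp id 2 ν) :
    cov[fun z => z.1 + z.2, f; μ.prod ν]
      = cov[id, fun x => ∫ y, f (x, y) ∂ν; μ] + cov[id, fun y => ∫ x, f (x, y) ∂μ; ν] := by
  have hf2 := hf.memLp hm hμ hν
  have hA2 := hf.memLp_average hm hμ hν
  have hB2 := hf.memLp_average' hm hμ hν
  have h1 : MemLp (fun z : ℝ × ℝ => z.1) 2 (μ.prod ν) := hμ.comp_fst ν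
  have h2 : MemLp (fun z : ℝ × ℝ => z.2) 2 (μ.prod ν) := hν.comp_snd μ
  have hfi : Integrable f (μ.prod ν) := hf2.integrable one_le_two
  have e : (fun z : ℝ × ℝ => z.1 + z.2) = (fun z : ℝ × ℝ => z.1) + fun z => z.2 := rfl
  have i1 : Integrable (fun z : ℝ × ℝ => z.1 * f z) (μ.prod ν) := h1.integrable_mul hf2
  have i2 : Integrable (fun z : ℝ × ℝ => z.2 * f z) (μ.prod ν) := h2.integrable_mul hf2
  rw [e, covariance_add_left h1 h2 hf2, covariance_eq_sub h1 hf2, covariance_eq_sub h2 hf2,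
    covariance_eq_sub hμ hA2, covariance_eq_sub hν hB2]
  simp only [Pi.mul_apply, id]
  rw [integral_prod _ i1, integral_prod_symm _ i2, integral_fun_fst (fun x : ℝ => x),
    integral_fun_snd (fun x : ℝ => x)]
  simp only [integral_const_mul, probReal_univ, one_smul]
  rw [← integral_prod f hfi, ← integral_prod_symm f hfi]

end TwoVariables

/-! ### Primitives of bounded functions and shifts averaged over a law -/

/-- Bounded measurable functions: the derivatives of the test functions used below. -/
structure BddMeas (h : ℝ → ℝ) : Prop where
  measurable : Measurable h
  bounded : ∃ M, ∀ x, |h x| ≤ M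

/-- The primitive of `h` that vanishes at `0`. -/
noncomputable def primitive (h : ℝ → ℝ) (x : ℝ) : ℝ := ∫ t in (0 : ℝ)..x, h t

/-- `shiftAvg ν h x = E h(x + Y)` for `Y` with law `ν`. -/
noncomputable def shiftAvg (ν : Measure ℝ) (h : ℝ → ℝ) (x : ℝ) : ℝ := ∫ y, h (x + y) ∂ν

namespace BddMeas

variable {h h' : ℝ → ℝ}

theorem sub (hh : BddMeas h) (hh' : BddMeas h') : BddMeas (fun x => h x - h' x) := by
  obtain ⟨M, hM⟩ := hh.bounded
  obtain ⟨M', hM'⟩ := hh'.bounded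
  exact ⟨hh.measurable.sub hh'.measurable, M + M',
    fun x => (abs_sub _ _).trans (add_le_add (hM x) (hM' x))⟩

theorem const (c : ℝ) : BddMeas (fun _ => c) := ⟨measurable_const, |c|, fun _ => le_rfl⟩

theorem comp_add_const (hh : BddMeas h) (y : ℝ) : BddMeas (fun x => h (x + y)) := by
  obtain ⟨M, hM⟩ := hh.bounded
  exact ⟨hh.measurable.comp (measurable_id.add_const y), M, fun x => hM _⟩

theorem intervalIntegrable (hh : BddMeas h) (a b : ℝ) : IntervalIntegrable h volume a b := by
  obtain ⟨M, hM⟩ := hh.bounded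
  exact (intervalIntegrable_const (c := M)).mono_fun hh.measurable.aestronglyMeasurable
    (Filter.Eventually.of_forall fun x => (hM x).trans (le_abs_self _))

theorem memLp (hh : BddMeas h) (p : ℝ≥0∞) (μ : Measure ℝ) [IsFiniteMeasure μ] : MemLp h p μ := by
  obtain ⟨M, hM⟩ := hh.bounded
  exact MemLp.of_bound hh.measurable.aestronglyMeasurable M (Filter.Eventually.of_forall hM)

theorem integrable (hh : BddMeas h) (μ : Measure ℝ) [IsFiniteMeasure μ] : Integrable h μ :=
  memLp_one_iff_integrable.1 (hh.memLp 1 μ)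

theorem continuous_primitive (hh : BddMeas h) : Continuous (primitive h) :=
  intervalIntegral.continuous_primitive hh.intervalIntegrable 0

theorem abs_primitive_le (hh : BddMeas h) : ∃ M, 0 ≤ M ∧ ∀ x, |primitive h x| ≤ M * |x| := by
  obtain ⟨M, hM⟩ := hh.bounded
  refine ⟨M, (abs_nonneg _).trans (hM 0), fun x => ?_⟩
  have := intervalIntegral.norm_integral_le_of_norm_le_const (a := 0) (b := x) (f := h) (C := M)
    fun t _ => hM t
  simpa [primitive] using this

theorem memLp_primitive (hh : BddMeas h) {μ : Measure ℝ} [IsProbabilityMeasure μ]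
    (hμ : MemLp id 2 μ) : MemLp (primitive h) 2 μ := by
  obtain ⟨M, -, hM⟩ := hh.abs_primitive_le
  exact memLp_two_of_affine_bound hμ hh.continuous_primitive.measurable (a := 0) (b := M)
    fun x => by simpa using hM x

theorem primitive_sub (hh : BddMeas h) (hh' : BddMeas h') (x : ℝ) :
    primitive (fun t => h t - h' t) x = primitive h x - primitive h' x :=
  intervalIntegral.integral_sub (hh.intervalIntegrable _ _) (hh'.intervalIntegrable _ _)

theorem primitive_add (hh : BddMeas h) (x y : ℝ) :
    primitive h (x + y) = primitive h y + primitive (fun t => h (t + y)) x := by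
  unfold primitive
  rw [intervalIntegral.integral_comp_add_right (fun t => h t) y, zero_add,
    intervalIntegral.integral_add_adjacent_intervals (hh.intervalIntegrable _ _)
      (hh.intervalIntegrable _ _)]

variable (ν : Measure ℝ) [IsProbabilityMeasure ν]

theorem average (hh : BddMeas h) : BddMeas (shiftAvg ν h) := by
  obtain ⟨M, hM⟩ := hh.bounded
  refine ⟨measurable_average (f := fun z => h (z.1 + z.2))
    (hh.measurable.comp (measurable_fst.add measurable_snd)), M, fun x => ?_⟩
  have := norm_integral_le_of_norm_le_const (μ := ν) (f := fun y => h (x + y)) (C := M)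
    (Filter.Eventually.of_forall fun y => hM _)
  simpa [shiftAvg] using this

variable {ν}

/-- Averaging a primitive over shifts gives, up to a constant, the primitive of the average. -/
theorem shiftAvg_primitive (hh : BddMeas h) (hν : MemLp id 2 ν) (x : ℝ) :
    shiftAvg ν (primitive h) x
      = (∫ y, primitive h y ∂ν) + primitive (shiftAvg ν h) x := by
  have h1 : Integrable (primitive h) ν := (hh.memLp_primitive hν).integrable one_le_two
  have h2 : Integrable (fun y => primitive h (x + y)) ν := by
    obtain ⟨M, hM0, hM⟩ := hh.abs_primitive_le
    refine (memLp_two_of_affine_bound hν (hh.continuous_primitive.measurable.comp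
      (measurable_const_add x)) (a := M * |x|) (b := M) fun y => ?_).integrable one_le_two
    refine (hM _).trans ?_
    rw [← mul_add]
    exact mul_le_mul_of_nonneg_left (abs_add_le _ _) hM0
  have h3 : primitive (shiftAvg ν h) x = ∫ y, primitive (fun t => h (t + y)) x ∂ν := by
    unfold primitive shiftAvg
    refine intervalIntegral_integral_swap ?_
    obtain ⟨M, hM⟩ := hh.bounded
    have : IsFiniteMeasure (volume.restrict (Set.uIoc 0 x)) :=
      inferInstanceAs (IsFiniteMeasure (volume.restrict (Set.Ioc _ _)))
    refine Integrable.of_bound (C := M) (hh.measurable.comp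
      (measurable_fst.add measurable_snd)).aestronglyMeasurable
      (Filter.Eventually.of_forall fun z => hM _)
  have h4 : ∀ y, primitive (fun t => h (t + y)) x = primitive h (x + y) - primitive h y :=
    fun y => by rw [hh.primitive_add]; ring
  rw [h3]
  simp_rw [h4]
  rw [integral_sub h2 h1]
  unfold shiftAvg
  ring

end BddMeas

/-! ### The two functional inequalities and their behaviour under convolution -/

/-- The Poincaré inequality with constant `c` for the law `ν`, tested on primitives of bounded
measurable functions only. Convolution keeps this class of test functions, and no derivative has
to be taken. -/
def PoincareIneq (ν : Measure ℝ) (c : ℝ) : Prop :=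
  ∀ h, BddMeas h → Var[primitive h; ν] ≤ c * ∫ x, h x ^ 2 ∂ν

/-- Control of the covariance of the identity with functions whose derivative has mean zero. For
a Gaussian law it holds with `B = 0`. -/
def CovIneq (ν : Measure ℝ) (B : ℝ) : Prop :=
  ∀ h, BddMeas h → ∫ x, h x ∂ν = 0 → cov[id, primitive h; ν] ^ 2 ≤ B * ∫ x, h x ^ 2 ∂ν

theorem PoincareIneq.mono {ν : Measure ℝ} {c c' : ℝ} (h : PoincareIneq ν c) (hc : c ≤ c') :
    PoincareIneq ν c' := fun f hf =>
  (h f hf).trans (mul_le_mul_of_nonneg_right hc (integral_nonneg fun _ => sq_nonneg _))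

theorem primitive_one (x : ℝ) : primitive (fun _ => 1) x = x := by
  simp [primitive]

theorem PoincareIneq.variance_id_le {ν : Measure ℝ} [IsProbabilityMeasure ν] {c : ℝ}
    (h : PoincareIneq ν c) : Var[id; ν] ≤ c := by
  have := h (fun _ => 1) (BddMeas.const 1)
  have e : primitive (fun _ => 1) = id := funext primitive_one
  rw [e] at this
  simpa only [one_pow, integral_const, probReal_univ, smul_eq_mul, mul_one] using this

theorem covariance_sq_le {Ω : Type*} [MeasurableSpace Ω] {P : Measure Ω} [IsProbabilityMeasure P]
    {X Y : Ω → ℝ} (hX : MemLp X 2 P) (hY : MemLp Y 2 P) :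
    cov[X, Y; P] ^ 2 ≤ Var[X; P] * Var[Y; P] := by
  have key : ∀ t : ℝ, 0 ≤ Var[X; P] * (t * t) + 2 * cov[X, Y; P] * t + Var[Y; P] := fun t => by
    have h := variance_nonneg ((t • X) + Y) P
    rw [variance_add (hX.const_smul t) hY, covariance_smul_left, variance_smul] at h
    linarith
  have := discrim_le_zero key
  rw [discrim] at this
  linarith

theorem PoincareIneq.covIneq {ν : Measure ℝ} [IsProbabilityMeasure ν] {c : ℝ}
    (h : PoincareIneq ν c) (hν : MemLp id 2 ν) : CovIneq ν (Var[id; ν] * c) := fun f hf _ => by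
  refine (covariance_sq_le hν (hf.memLp_primitive hν)).trans ?_
  rw [mul_assoc]
  exact mul_le_mul_of_nonneg_left (h f hf) (variance_nonneg _ _)

theorem BddMeas.integral_conv {μ ν : Measure ℝ} {h : ℝ → ℝ} (hh : BddMeas h) :
    ∫ z, h z ∂(μ ∗ ν) = ∫ z : ℝ × ℝ, h (z.1 + z.2) ∂(μ.prod ν) :=
  integral_map (by fun_prop) hh.measurable.aestronglyMeasurable

section Convolution

variable {μ ν : Measure ℝ} [IsProbabilityMeasure μ] [IsProbabilityMeasure ν] {h : ℝ → ℝ}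

theorem memLp_id_conv {p : ℝ≥0∞} (hμ : MemLp id p μ) (hν : MemLp id p ν) :
    MemLp id p (μ ∗ ν) := by
  have h1 : MemLp (fun z : ℝ × ℝ => z.1) p (μ.prod ν) := hμ.comp_fst ν
  have h2 : MemLp (fun z : ℝ × ℝ => z.2) p (μ.prod ν) := hν.comp_snd μ
  have h3 := h1.add h2
  have hm : AEMeasurable (fun z : ℝ × ℝ => z.1 + z.2) (μ.prod ν) := by fun_prop
  unfold Measure.conv
  rw [memLp_map_measure_iff aestronglyMeasurable_id hm]
  exact h3

theorem variance_id_conv (hμ : MemLp id 2 μ) (hν : MemLp id 2 ν) :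
    Var[id; μ ∗ ν] = Var[id; μ] + Var[id; ν] := by
  have h1 : Var[fun z : ℝ × ℝ => id z.1 + id z.2; μ.prod ν] = Var[id; μ] + Var[id; ν] :=
    variance_add_prod hμ hν
  have hm : AEMeasurable (fun z : ℝ × ℝ => z.1 + z.2) (μ.prod ν) := by fun_prop
  rw [← h1]
  exact variance_id_map hm

theorem BddMeas.measurable_sum (hh : BddMeas h) : Measurable (fun z : ℝ × ℝ => h (z.1 + z.2)) :=
  hh.measurable.comp (measurable_fst.add measurable_snd)

theorem BddMeas.linearGrowth_sum (hh : BddMeas h) :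
    LinearGrowth (fun z => h (z.1 + z.2)) := by
  obtain ⟨M, hM⟩ := hh.bounded
  have hM0 : 0 ≤ M := (abs_nonneg _).trans (hM 0)
  refine ⟨M, fun z => (hM _).trans ?_⟩
  nlinarith [mul_nonneg hM0 (abs_nonneg z.1), mul_nonneg hM0 (abs_nonneg z.2)]

theorem BddMeas.linearGrowth_primitive_sum (hh : BddMeas h) :
    LinearGrowth (fun z => primitive h (z.1 + z.2)) := by
  obtain ⟨M, hM0, hM⟩ := hh.abs_primitive_le
  refine ⟨M, fun z => (hM _).trans (mul_le_mul_of_nonneg_left ?_ hM0)⟩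
  linarith [abs_add_le z.1 z.2]

theorem BddMeas.sq (hh : BddMeas h) : BddMeas (fun x => h x ^ 2) := by
  obtain ⟨M, hM⟩ := hh.bounded
  refine ⟨hh.measurable.pow_const 2, M ^ 2, fun x => ?_⟩
  rw [abs_pow]
  exact pow_le_pow_left₀ (abs_nonneg _) (hM x) 2

theorem BddMeas.integrable_sum (hh : BddMeas h) :
    Integrable (fun z : ℝ × ℝ => h (z.1 + z.2)) (μ.prod ν) := by
  obtain ⟨M, hM⟩ := hh.bounded
  exact Integrable.of_bound hh.measurable_sum.aestronglyMeasurable M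
    (Filter.Eventually.of_forall fun z => hM _)

theorem BddMeas.integral_shiftAvg (hh : BddMeas h) :
    ∫ x, shiftAvg ν h x ∂μ = ∫ z, h z ∂(μ ∗ ν) := by
  rw [hh.integral_conv, integral_prod _ hh.integrable_sum]
  rfl

/-- The decomposition `variance_prod_eq` for a primitive evaluated at an independent sum. -/
theorem BddMeas.variance_primitive_conv (hh : BddMeas h) (hμ : MemLp id 2 μ)
    (hν : MemLp id 2 ν) :
    Var[primitive h; μ ∗ ν] = Var[primitive (shiftAvg ν h); μ] + Var[primitive (shiftAvg μ h); ν]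
      + ∫ y, Var[primitive (fun t => h (t + y) - shiftAvg ν h t); μ] ∂ν := by
  have hc := hh.continuous_primitive
  have e1 : Var[primitive h; μ ∗ ν] = Var[fun z : ℝ × ℝ => primitive h (z.1 + z.2); μ.prod ν] :=
    variance_map hc.aemeasurable (by fun_prop)
  have e2 : ∀ x, ∫ y, primitive h (x + y) ∂ν
      = (∫ y, primitive h y ∂ν) + primitive (shiftAvg ν h) x := hh.shiftAvg_primitive hν
  have e3 : ∀ y, ∫ x, primitive h (x + y) ∂μ
      = (∫ x, primitive h x ∂μ) + primitive (shiftAvg μ h) y := fun y => by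
    simp_rw [add_comm _ y]
    exact hh.shiftAvg_primitive hμ y
  have e4 : ∀ y x, primitive h (x + y) - ((∫ y, primitive h y ∂ν) + primitive (shiftAvg ν h) x)
      = (primitive h y - ∫ y, primitive h y ∂ν)
        + primitive (fun t => h (t + y) - shiftAvg ν h t) x := fun y x => by
    rw [(hh.comp_add_const y).primitive_sub (hh.average ν), hh.primitive_add]
    ring
  rw [e1, variance_prod_eq hh.linearGrowth_primitive_sum
    (hc.comp (continuous_fst.add continuous_snd)).measurable hμ hν]
  simp only [e2, e3, e4]
  have m1 := (hh.average ν).continuous_primitive.aestronglyMeasurable (μ := μ)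
  have m2 := (hh.average μ).continuous_primitive.aestronglyMeasurable (μ := ν)
  have m3 := fun y => ((hh.comp_add_const y).sub
    (hh.average ν)).continuous_primitive.aestronglyMeasurable (μ := μ)
  simp only [variance_const_add m1, variance_const_add m2, variance_const_add (m3 _)]

theorem BddMeas.integrable_interaction_sq (hh : BddMeas h) :
    Integrable (fun z : ℝ × ℝ => (h (z.1 + z.2) - shiftAvg ν h z.1) ^ 2) (μ.prod ν) := by
  obtain ⟨M, hM⟩ := hh.bounded
  obtain ⟨M', hM'⟩ := (hh.average ν).bounded
  refine Integrable.of_bound ((hh.measurable_sum.sub ((hh.average ν).measurable.comp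
    measurable_fst)).pow_const 2).aestronglyMeasurable ((M + M') ^ 2)
    (Filter.Eventually.of_forall fun z => ?_)
  rw [norm_pow]
  exact pow_le_pow_left₀ (norm_nonneg _) ((abs_sub _ _).trans (add_le_add (hM _) (hM' _))) 2

theorem BddMeas.integral_interaction_sq (hh : BddMeas h) :
    ∫ y, ∫ x, (h (x + y) - shiftAvg ν h x) ^ 2 ∂μ ∂ν
      = (∫ z, h z ^ 2 ∂(μ ∗ ν)) - ∫ x, shiftAvg ν h x ^ 2 ∂μ := by
  have hi := hh.integrable_interaction_sq (μ := μ) (ν := ν)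
  have hinner : ∀ x, ∫ y, (h (x + y) - shiftAvg ν h x) ^ 2 ∂ν
      = (∫ y, h (x + y) ^ 2 ∂ν) - shiftAvg ν h x ^ 2 := fun x => by
    have hb : BddMeas (fun y => h (x + y)) := by
      simpa only [add_comm x] using hh.comp_add_const x
    have h2 := variance_eq_sub (hb.memLp 2 ν)
    rw [variance_eq_integral hb.measurable.aemeasurable] at h2
    exact h2
  rw [← integral_prod_symm _ hi, integral_prod _ hi]
  simp only [hinner]
  rw [integral_sub (hh.sq.integrable_sum.integral_prod_left) ((hh.average ν).sq.integrable μ),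
    ← integral_prod _ hh.sq.integrable_sum, hh.sq.integral_conv]

theorem BddMeas.integral_shiftAvg_sq_le (hh : BddMeas h) :
    ∫ x, shiftAvg ν h x ^ 2 ∂μ ≤ ∫ z, h z ^ 2 ∂(μ ∗ ν) := by
  have h1 := hh.integral_interaction_sq (μ := μ) (ν := ν)
  have h2 : 0 ≤ ∫ y, ∫ x, (h (x + y) - shiftAvg ν h x) ^ 2 ∂μ ∂ν :=
    integral_nonneg fun y => integral_nonneg fun x => sq_nonneg _
  linarith

/-- Bessel's inequality for the two main effects of a mean zero function of a sum. -/
theorem BddMeas.integral_shiftAvg_sq_add_le (hh : BddMeas h) (hμ : MemLp id 2 μ)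
    (hν : MemLp id 2 ν) (h0 : ∫ z, h z ∂(μ ∗ ν) = 0) :
    ∫ x, shiftAvg ν h x ^ 2 ∂μ + ∫ y, shiftAvg μ h y ^ 2 ∂ν ≤ ∫ z, h z ^ 2 ∂(μ ∗ ν) := by
  have h1 := variance_prod_eq hh.linearGrowth_sum hh.measurable_sum hμ hν
  have e1 : Var[fun z : ℝ × ℝ => h (z.1 + z.2); μ.prod ν] = ∫ z, h z ^ 2 ∂(μ ∗ ν) := by
    rw [hh.integral_conv] at h0
    rw [variance_of_integral_eq_zero hh.measurable_sum.aemeasurable h0, hh.sq.integral_conv]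
  have e2 : Var[shiftAvg ν h; μ] = ∫ x, shiftAvg ν h x ^ 2 ∂μ :=
    variance_of_integral_eq_zero (hh.average ν).measurable.aemeasurable
      (hh.integral_shiftAvg.trans h0)
  have e3 : Var[shiftAvg μ h; ν] = ∫ x, shiftAvg μ h x ^ 2 ∂ν :=
    variance_of_integral_eq_zero (hh.average μ).measurable.aemeasurable
      (by rw [hh.integral_shiftAvg, Measure.conv_comm]; exact h0)
  have e4 : (fun y => ∫ x, h (x + y) ∂μ) = shiftAvg μ h := by
    funext y
    simp_rw [add_comm _ y]
    rfl
  have h2 : 0 ≤ ∫ y, Var[fun x => h (x + y) - ∫ y', h (x + y') ∂ν; μ] ∂ν :=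
    integral_nonneg fun y => variance_nonneg _ _
  rw [e1, e4] at h1
  have e5 : Var[fun x => ∫ y, h (x + y) ∂ν; μ] = ∫ x, shiftAvg ν h x ^ 2 ∂μ := e2
  simp only at h1
  rw [e5, e3] at h1
  linarith

theorem PoincareIneq.integral_variance_interaction_le {c : ℝ} (hP : PoincareIneq μ c)
    (hh : BddMeas h) :
    ∫ y, Var[primitive (fun t => h (t + y) - shiftAvg ν h t); μ] ∂ν
      ≤ c * ((∫ z, h z ^ 2 ∂(μ ∗ ν)) - ∫ x, shiftAvg ν h x ^ 2 ∂μ) := by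
  rw [← hh.integral_interaction_sq, ← integral_const_mul]
  refine integral_mono_of_nonneg (Filter.Eventually.of_forall fun y => variance_nonneg _ _) ?_
    (Filter.Eventually.of_forall fun y => hP _ ((hh.comp_add_const y).sub (hh.average ν)))
  exact (hh.integrable_interaction_sq.integral_prod_right).const_mul c

/-- Poincaré constants are subadditive under convolution. -/
theorem PoincareIneq.conv {c₁ c₂ : ℝ} (h₁ : PoincareIneq μ c₁) (h₂ : PoincareIneq ν c₂)
    (hμ : MemLp id 2 μ) (hν : MemLp id 2 ν) : PoincareIneq (μ ∗ ν) (c₁ + c₂) := fun h hh => by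
  have hc₂ : 0 ≤ c₂ := (variance_nonneg _ _).trans h₂.variance_id_le
  have i1 := h₁ _ (hh.average ν)
  have i2 := h₂ _ (hh.average μ)
  have i3 := h₁.integral_variance_interaction_le (ν := ν) hh
  have i4 : ∫ y, shiftAvg μ h y ^ 2 ∂ν ≤ ∫ z, h z ^ 2 ∂(μ ∗ ν) := by
    rw [Measure.conv_comm]
    exact hh.integral_shiftAvg_sq_le
  rw [hh.variance_primitive_conv hμ hν]
  nlinarith [mul_le_mul_of_nonneg_left i4 hc₂]

theorem CovIneq.conv {B₁ B₂ : ℝ} (h₁ : CovIneq μ B₁) (h₂ : CovIneq ν B₂) (hB₁ : 0 ≤ B₁)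
    (hB₂ : 0 ≤ B₂) (hμ : MemLp id 2 μ) (hν : MemLp id 2 ν) :
    CovIneq (μ ∗ ν) (B₁ + B₂) := fun h hh h0 => by
  have hc := hh.continuous_primitive
  have i1 := h₁ _ (hh.average ν) (hh.integral_shiftAvg.trans h0)
  have i2 := h₂ _ (hh.average μ) (by rw [hh.integral_shiftAvg, Measure.conv_comm]; exact h0)
  have i3 := hh.integral_shiftAvg_sq_add_le hμ hν h0
  have e1 : cov[id, primitive h; μ ∗ ν]
      = cov[fun z : ℝ × ℝ => z.1 + z.2, fun z => primitive h (z.1 + z.2); μ.prod ν] :=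
    covariance_map aestronglyMeasurable_id hc.aestronglyMeasurable (by fun_prop)
  have e2 : ∀ x, ∫ y, primitive h (x + y) ∂ν
      = (∫ y, primitive h y ∂ν) + primitive (shiftAvg ν h) x := hh.shiftAvg_primitive hν
  have e3 : ∀ y, ∫ x, primitive h (x + y) ∂μ
      = (∫ x, primitive h x ∂μ) + primitive (shiftAvg μ h) y := fun y => by
    simp_rw [add_comm _ y]
    exact hh.shiftAvg_primitive hμ y
  rw [covariance_add_prod hh.linearGrowth_primitive_sum
    (hc.comp (continuous_fst.add continuous_snd)).measurable hμ hν] at e1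
  simp only [e2, e3] at e1
  rw [covariance_const_add_right (((hh.average ν).memLp_primitive hμ).integrable one_le_two),
    covariance_const_add_right (((hh.average μ).memLp_primitive hν).integrable one_le_two)] at e1
  rw [e1]
  set u := cov[id, primitive (shiftAvg ν h); μ]
  set v := cov[id, primitive (shiftAvg μ h); ν]
  set p := ∫ x, shiftAvg ν h x ^ 2 ∂μ
  set q := ∫ y, shiftAvg μ h y ^ 2 ∂ν
  have hp : 0 ≤ p := integral_nonneg fun _ => sq_nonneg _
  have hq : 0 ≤ q := integral_nonneg fun _ => sq_nonneg _
  -- `2uv ≤ 2√(B₁p B₂q) ≤ B₁q + B₂p`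
  have huv : 2 * (u * v) ≤ B₁ * q + B₂ * p := by
    refine abs_le_of_sq_le_sq' ?_ (by positivity) |>.2
    have : u ^ 2 * v ^ 2 ≤ (B₁ * p) * (B₂ * q) :=
      mul_le_mul i1 i2 (sq_nonneg _) (by positivity)
    nlinarith [sq_nonneg (B₁ * q - B₂ * p)]
  nlinarith [mul_le_mul_of_nonneg_left i3 (add_nonneg hB₁ hB₂)]

/-- On functions whose derivative has mean zero, the Poincaré constant of a sum of two
independent copies gains a factor `3/4` over subadditivity: each main effect of the derivative
carries at most half of its norm, and the interaction is tested in one variable only. -/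
theorem PoincareIneq.variance_conv_self_le {c : ℝ} (hP : PoincareIneq μ c) (hμ : MemLp id 2 μ)
    (hh : BddMeas h) (h0 : ∫ z, h z ∂(μ ∗ μ) = 0) :
    Var[primitive h; μ ∗ μ] ≤ 3 / 2 * c * ∫ z, h z ^ 2 ∂(μ ∗ μ) := by
  have hc : 0 ≤ c := (variance_nonneg _ _).trans hP.variance_id_le
  have i1 := hP _ (hh.average μ)
  have i3 := hP.integral_variance_interaction_le (ν := μ) hh
  have i4 := hh.integral_shiftAvg_sq_add_le hμ hμ h0
  rw [hh.variance_primitive_conv hμ hμ]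
  nlinarith [mul_le_mul_of_nonneg_left i4 hc]

end Convolution

/-- The Poincaré constant from its restriction to functions with mean zero derivative, the
variance, and the covariance bound. The free parameter `K` balances the cross term between the
linear part of a test function and the rest. -/
theorem PoincareIneq.of_mean_zero {ν : Measure ℝ} [IsProbabilityMeasure ν] (hν : MemLp id 2 ν)
    {b B K : ℝ} (hK : 0 < K)
    (h1 : ∀ h, BddMeas h → ∫ x, h x ∂ν = 0 → Var[primitive h; ν] ≤ b * ∫ x, h x ^ 2 ∂ν)
    (h2 : CovIneq ν B) : PoincareIneq ν (max (Var[id; ν] + K) (b + B / K)) := fun h hh => by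
  set a := ∫ x, h x ∂ν with ha
  have hh0 : BddMeas (fun x => h x - a) := hh.sub (BddMeas.const a)
  have hm0 : ∫ x, (h x - a) ∂ν = 0 := by
    rw [integral_sub (hh.integrable ν) (integrable_const _)]
    simp [ha]
  have e1 : primitive h = (a • id) + primitive (fun x => h x - a) := by
    funext x
    have h3 := hh.primitive_sub (BddMeas.const a) x
    have h4 : primitive (fun _ => a) x = a * x := by simp [primitive, mul_comm]
    simp only [Pi.add_apply, Pi.smul_apply, id, smul_eq_mul]
    linarith
  have e2 : ∫ x, h x ^ 2 ∂ν = a ^ 2 + ∫ x, (h x - a) ^ 2 ∂ν := by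
    have h3 := variance_eq_sub (hh.memLp 2 ν)
    rw [variance_eq_integral hh.measurable.aemeasurable] at h3
    simp only [Pi.pow_apply, ← ha] at h3
    linarith
  have i1 := h1 _ hh0 hm0
  have i2 := h2 _ hh0 hm0
  rw [e1, variance_add (hν.const_smul a) (hh0.memLp_primitive hν), variance_smul,
    covariance_smul_left, e2]
  set w := ∫ x, (h x - a) ^ 2 ∂ν
  set C := cov[id, primitive (fun x => h x - a); ν]
  set s := Var[id; ν]
  have hw : 0 ≤ w := integral_nonneg fun _ => sq_nonneg _
  have i3 : 2 * (a * C) ≤ K * a ^ 2 + B / K * w := by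
    have h3 : C ^ 2 / K ≤ B / K * w := by
      rw [div_mul_eq_mul_div]
      exact div_le_div_of_nonneg_right i2 hK.le
    have h4 : K * a ^ 2 + C ^ 2 / K - 2 * (a * C) = (K * a - C) ^ 2 / K := by
      field_simp
      ring
    have h5 : 0 ≤ (K * a - C) ^ 2 / K := by positivity
    linarith
  have i4 := mul_le_mul_of_nonneg_right (le_max_left (s + K) (b + B / K)) (sq_nonneg a)
  have i5 := mul_le_mul_of_nonneg_right (le_max_right (s + K) (b + B / K)) hw
  nlinarith

/-! ### Convolution powers -/

/-- The law of the sum of `n` independent variables with law `μ`. -/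
noncomputable def convPow (μ : Measure ℝ) : ℕ → Measure ℝ
  | 0 => Measure.dirac 0
  | n + 1 => convPow μ n ∗ μ

section ConvPow

variable (μ : Measure ℝ) [IsProbabilityMeasure μ]

instance isProbabilityMeasure_convPow : ∀ n, IsProbabilityMeasure (convPow μ n)
  | 0 => inferInstanceAs (IsProbabilityMeasure (Measure.dirac (0 : ℝ)))
  | n + 1 => by
    have := isProbabilityMeasure_convPow n
    exact inferInstanceAs (IsProbabilityMeasure (convPow μ n ∗ μ))

theorem convPow_one : convPow μ 1 = μ := Measure.dirac_zero_conv μ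

theorem convPow_add (m n : ℕ) : convPow μ (m + n) = convPow μ m ∗ convPow μ n := by
  induction n with
  | zero => exact (Measure.conv_dirac_zero _).symm
  | succ n ih =>
    rw [← add_assoc]
    change convPow μ (m + n) ∗ μ = convPow μ m ∗ (convPow μ n ∗ μ)
    rw [ih, Measure.conv_assoc]

theorem convPow_two_mul (n : ℕ) : convPow μ (2 * n) = convPow μ n ∗ convPow μ n := by
  rw [two_mul, convPow_add]

variable {μ}

theorem memLp_id_dirac (p : ℝ≥0∞) (a : ℝ) : MemLp id p (Measure.dirac a) :=
  MemLp.of_bound aestronglyMeasurable_id ‖a‖ (by rw [ae_dirac_eq]; exact le_refl ‖a‖)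

theorem memLp_id_convPow {p : ℝ≥0∞} (hμ : MemLp id p μ) (n : ℕ) :
    MemLp id p (convPow μ n) := by
  induction n with
  | zero => exact memLp_id_dirac p 0
  | succ n ih => exact memLp_id_conv ih hμ

theorem variance_id_convPow (hμ : MemLp id 2 μ) (n : ℕ) :
    Var[id; convPow μ n] = n * Var[id; μ] := by
  induction n with
  | zero => simp [convPow, variance_dirac]
  | succ n ih =>
    rw [convPow, variance_id_conv (memLp_id_convPow hμ n) hμ, ih]
    push_cast
    ring

theorem CovIneq.convPow {B : ℝ} (hB : 0 ≤ B) (h : CovIneq μ B) (hμ : MemLp id 2 μ) (n : ℕ) :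
    CovIneq (convPow μ n) (n * B) := by
  induction n with
  | zero =>
    intro f hf _
    have h1 := covariance_sq_le (memLp_id_dirac 2 0) (hf.memLp_primitive (memLp_id_dirac 2 0))
    rw [variance_dirac, zero_mul] at h1
    rw [Nat.cast_zero, zero_mul, zero_mul]
    exact h1
  | succ n ih =>
    have := ih.conv h (by positivity) hB (memLp_id_convPow hμ n) hμ
    rw [_root_.convPow]
    convert this using 1
    push_cast
    ring

end ConvPow

/-! ### Growth of the Poincaré constant along convolution powers -/

/-- A subadditive quantity which, when its index doubles, grows by the factor `3/2` (and an error
of an eighth of the index) unless it is already within a constant of the index, stays within a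
constant of the index. Here `Q n c` reads "the quantity at `n` is at most `c`".

Along powers of two the first alternative brings `c / n` geometrically below `5/4`; blocks of such
a length `M` keep this bound by subadditivity, and one more doubling then reaches the second
alternative. -/
theorem exists_bound_of_subadditive_of_doubling {ρ : ℝ} (hρ : 0 < ρ) :
    ∃ C : ℝ, ∀ Q : ℕ → ℝ → Prop, (∀ n c c', c ≤ c' → Q n c → Q n c') → Q 0 0 → Q 1 ρ →
      (∀ m n a b, Q m a → Q n b → Q (m + n) (a + b)) →
      (∀ m c, Q m c → Q (2 * m) (max (2 * m + 16 * ρ) (3 / 2 * c + m / 8))) →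
      ∀ n : ℕ, Q n (n + C) := by
  obtain ⟨k, hk⟩ : ∃ k : ℕ, (16 * ρ) * (3 / 4 : ℝ) ^ k ≤ 1 / 4 := by
    obtain ⟨k, hk⟩ := exists_pow_lt_of_lt_one (show (0 : ℝ) < 1 / (64 * ρ) by positivity)
      (show (3 / 4 : ℝ) < 1 by norm_num)
    refine ⟨k, ?_⟩
    rw [lt_div_iff₀ (by positivity)] at hk
    linarith
  refine ⟨16 * ρ + 2 * 2 ^ k * ρ, fun Q hmono h0 h1 hadd hdouble n => ?_⟩
  have hpow : ∀ j : ℕ, Q (2 ^ j) (2 ^ j * (1 + 16 * ρ * (3 / 4) ^ j)) := by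
    intro j
    induction j with
    | zero => exact hmono _ _ _ (by norm_num; linarith) h1
    | succ j ih =>
      have h2 := hdouble _ _ ih
      rw [← pow_succ'] at h2
      refine hmono _ _ _ (max_le ?_ ?_) h2
      · have h3 : (1 : ℝ) ≤ 2 ^ (j + 1) * (3 / 4) ^ (j + 1) := by
          rw [← mul_pow]
          exact one_le_pow₀ (by norm_num)
        push_cast
        rw [pow_succ'] at h3 ⊢
        nlinarith
      · have h3 : (0 : ℝ) < 2 ^ j := by positivity
        push_cast
        rw [pow_succ, pow_succ (3 / 4 : ℝ)]
        nlinarith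
  have hlin : ∀ r : ℕ, Q r (r * ρ) := by
    intro r
    induction r with
    | zero => simpa using h0
    | succ r ih => exact hmono _ _ _ (by push_cast; linarith) (hadd _ _ _ _ ih h1)
  have hM : Q (2 ^ k) (2 ^ k * (5 / 4)) :=
    hmono _ _ _ (by gcongr; linarith) (hpow k)
  have hblock : ∀ b : ℕ, Q (b * 2 ^ k) (b * 2 ^ k * (5 / 4)) := by
    intro b
    induction b with
    | zero => simpa using h0
    | succ b ih =>
      rw [add_one_mul]
      exact hmono _ _ _ (by push_cast; linarith) (hadd _ _ _ _ ih hM)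
  have heven : ∀ b : ℕ, Q (2 * (b * 2 ^ k)) (2 * (b * 2 ^ k) + 16 * ρ) := by
    intro b
    refine hmono _ _ _ (max_le ?_ ?_) (hdouble _ _ (hblock b))
    · push_cast
      exact le_rfl
    · push_cast
      linarith
  set b := n / (2 * 2 ^ k) with hb
  set r := n % (2 * 2 ^ k) with hr
  have hn : n = 2 * (b * 2 ^ k) + r := by
    have := Nat.div_add_mod n (2 * 2 ^ k)
    rw [← hb, ← hr] at this
    linarith
  have hrlt : (r : ℝ) ≤ 2 * 2 ^ k := by
    have : r < 2 * 2 ^ k := Nat.mod_lt _ (by positivity)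
    exact_mod_cast this.le
  have h2 := hadd _ _ _ _ (heven b) (hlin r)
  rw [← hn] at h2
  refine hmono _ _ _ ?_ h2
  have h3 : (n : ℝ) = 2 * (b * 2 ^ k) + r := by exact_mod_cast hn
  have h4 : (r : ℝ) * ρ ≤ 2 * 2 ^ k * ρ := mul_le_mul_of_nonneg_right hrlt hρ.le
  have h5 : (0 : ℝ) ≤ r := Nat.cast_nonneg r
  linarith

/-- For a law with variance `s²` and Poincaré constant at most `ρ s²`, the Poincaré constants of
its convolution powers exceed the variances by a bounded amount. -/
theorem exists_poincareIneq_convPow {ρ : ℝ} (hρ : 0 < ρ) :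
    ∃ C : ℝ, ∀ (μ : Measure ℝ) [IsProbabilityMeasure μ], MemLp id 2 μ → 0 < Var[id; μ] →
      PoincareIneq μ (ρ * Var[id; μ]) →
      ∀ n : ℕ, PoincareIneq (convPow μ n) ((n + C) * Var[id; μ]) := by
  obtain ⟨C, hC⟩ := exists_bound_of_subadditive_of_doubling hρ
  refine ⟨C, fun μ _ hμ hs hP => hC (fun n c => PoincareIneq (convPow μ n) (c * Var[id; μ]))
    (fun n c c' hc h => h.mono (mul_le_mul_of_nonneg_right hc hs.le)) ?_ ?_ ?_ ?_⟩
  · intro h _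
    have : Var[primitive h; Measure.dirac (0 : ℝ)] = 0 := variance_dirac _
    simp only [convPow, zero_mul]
    exact this.le
  · rwa [convPow_one]
  · intro m n a b ha hb
    rw [convPow_add, add_mul]
    exact ha.conv hb (memLp_id_convPow hμ m) (memLp_id_convPow hμ n)
  · intro m c hc
    have hcov := (hP.covIneq hμ).convPow (by positivity) hμ (2 * m)
    have hpos : 0 < 16 * ρ * Var[id; μ] := by positivity
    have h1 : ∀ h, BddMeas h → ∫ x, h x ∂(convPow μ (2 * m)) = 0 →
        Var[primitive h; convPow μ (2 * m)]
          ≤ 3 / 2 * (c * Var[id; μ]) * ∫ x, h x ^ 2 ∂(convPow μ (2 * m)) := by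
      rw [convPow_two_mul]
      exact fun h hh h0 => hc.variance_conv_self_le (memLp_id_convPow hμ m) hh h0
    refine (PoincareIneq.of_mean_zero (memLp_id_convPow hμ _) hpos h1 hcov).mono ?_
    rw [variance_id_convPow hμ, max_mul_of_nonneg _ _ hs.le]
    refine max_le_max (le_of_eq ?_) (le_of_eq ?_)
    · push_cast
      ring
    · push_cast
      field_simp
      ring

/-! ### From absolutely continuous test functions to primitives and back -/

theorem BddMeas.isAbsCont_primitive {h : ℝ → ℝ} (hh : BddMeas h) : IsAbsCont (primitive h) := by
  intro a b
  have hle : -(|a| + |b|) ≤ |a| + |b| := by linarith [abs_nonneg a, abs_nonneg b]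
  have h1 := (hh.intervalIntegrable (-(|a| + |b|))
    (|a| + |b|)).absolutelyContinuousOnInterval_intervalIntegral (c := 0) (by
      rw [Set.uIcc_of_le hle]
      constructor <;> linarith [abs_nonneg a, abs_nonneg b])
  refine h1.mono ?_
  rw [Set.uIcc_of_le hle]
  refine Set.uIcc_subset_Icc ?_ ?_ <;> constructor <;>
    linarith [abs_nonneg a, abs_nonneg b, neg_abs_le a, neg_abs_le b, le_abs_self a, le_abs_self b]

theorem BddMeas.ae_deriv_primitive {h : ℝ → ℝ} (hh : BddMeas h) :
    ∀ᵐ x, deriv (primitive h) x = h x := by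
  have h1 : LocallyIntegrable h volume := by
    obtain ⟨M, hM⟩ := hh.bounded
    exact (locallyIntegrable_const M).mono hh.measurable.aestronglyMeasurable
      (Filter.Eventually.of_forall fun x => (hM x).trans (le_abs_self _))
  filter_upwards [LocallyIntegrable.ae_hasDerivAt_integral h1] with x hx
  exact (hx 0).deriv

theorem IsAbsCont.continuous {g : ℝ → ℝ} (hg : IsAbsCont g) : Continuous g := by
  refine continuous_iff_continuousAt.2 fun x => ?_
  refine (hg (x - 1) (x + 1)).continuousOn.continuousAt ?_
  rw [Set.uIcc_of_le (by linarith)]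
  exact Icc_mem_nhds (by linarith) (by linarith)

theorem BddMeas.lintegral_sq {h : ℝ → ℝ} (hh : BddMeas h) (ν : Measure ℝ) [IsFiniteMeasure ν] :
    ∫⁻ y, ENNReal.ofReal (h y ^ 2) ∂ν = ENNReal.ofReal (∫ y, h y ^ 2 ∂ν) :=
  (ofReal_integral_eq_lintegral_ofReal (hh.memLp 2 ν).integrable_sq
    (Filter.Eventually.of_forall fun _ => sq_nonneg _)).symm

theorem evariance_le_of_poincareConst_le {ν : Measure ℝ} {c : ℝ≥0∞} (hc : c ≠ ∞)
    (hR : poincareConst ν ≤ c) {g : ℝ → ℝ} (hg : IsAbsCont g)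
    (hd : ∫⁻ y, ENNReal.ofReal ((deriv g y) ^ 2) ∂ν < ∞) :
    evariance g ν ≤ c * ∫⁻ y, ENNReal.ofReal ((deriv g y) ^ 2) ∂ν := by
  rcases eq_or_ne (evariance g ν) 0 with h0 | h0
  · rw [h0]
    exact zero_le
  · have h1 : evariance g ν / ∫⁻ y, ENNReal.ofReal ((deriv g y) ^ 2) ∂ν ≤ c :=
      (le_iSup₂ (f := fun g (_ : g ∈ classH1 ν) =>
        evariance g ν / ∫⁻ y, ENNReal.ofReal ((deriv g y) ^ 2) ∂ν) g
        ⟨hg, pos_iff_ne_zero.2 h0, hd⟩).trans hR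
    exact (ENNReal.div_le_iff_le_mul (Or.inr hc) (Or.inl hd.ne)).1 h1

section Transfer

variable {ν : Measure ℝ} [IsProbabilityMeasure ν] {c : ℝ}

theorem memLp_id_of_poincareConst_le (hR : poincareConst ν ≤ ENNReal.ofReal c) :
    MemLp id 2 ν := by
  have h1 := evariance_le_of_poincareConst_le ENNReal.ofReal_ne_top hR (g := id)
    (fun a b =>
      (LipschitzWith.id.lipschitzOnWith (s := Set.uIcc a b)).absolutelyContinuousOnInterval)
    (by simp)
  rw [← evariance_lt_top_iff_memLp aestronglyMeasurable_id]
  refine h1.trans_lt ?_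
  simp

theorem poincareIneq_of_poincareConst_le (hν : ν ≪ volume) (hc : 0 ≤ c)
    (hR : poincareConst ν ≤ ENNReal.ofReal c) : PoincareIneq ν c := fun h hh => by
  have h2 : ∫⁻ y, ENNReal.ofReal ((deriv (primitive h) y) ^ 2) ∂ν
      = ENNReal.ofReal (∫ y, h y ^ 2 ∂ν) := by
    rw [← hh.lintegral_sq]
    refine lintegral_congr_ae ?_
    filter_upwards [hν.ae_le hh.ae_deriv_primitive] with x hx
    rw [hx]
  have h1 := evariance_le_of_poincareConst_le ENNReal.ofReal_ne_top hR hh.isAbsCont_primitive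
    (by rw [h2]; exact ENNReal.ofReal_lt_top)
  have h0 : 0 ≤ ∫ y, h y ^ 2 ∂ν := integral_nonneg fun _ => sq_nonneg _
  rw [h2, ← ENNReal.ofReal_mul hc,
    ← ofReal_variance (hh.memLp_primitive (memLp_id_of_poincareConst_le hR))] at h1
  exact (ENNReal.ofReal_le_ofReal_iff (by positivity)).1 h1

/-- The variance as half the mean squared difference of two independent copies. It involves no
mean, and so passes to pointwise limits by Fatou's lemma. -/
theorem lintegral_sub_sq_eq {f : ℝ → ℝ} (hf : MemLp f 2 ν) :
    ∫⁻ z : ℝ × ℝ, ENNReal.ofReal ((f z.1 - f z.2) ^ 2) ∂(ν.prod ν) = 2 * evariance f ν := by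
  have h1 : MemLp (fun z : ℝ × ℝ => f z.1) 2 (ν.prod ν) := hf.comp_fst ν
  have h2 : MemLp (fun z : ℝ × ℝ => f z.2) 2 (ν.prod ν) := hf.comp_snd ν
  have h3 : MemLp (fun z : ℝ × ℝ => f z.1 - f z.2) 2 (ν.prod ν) := h1.sub h2
  have e1 : Var[fun z : ℝ × ℝ => f z.1 + -f z.2; ν.prod ν] = Var[f; ν] + Var[fun x => -f x; ν] :=
    variance_add_prod (Y := fun x => -f x) hf hf.neg
  have e2 : ∫ z : ℝ × ℝ, (f z.1 - f z.2) ∂(ν.prod ν) = 0 := by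
    rw [integral_sub (h1.integrable one_le_two) (h2.integrable one_le_two), integral_fun_fst,
      integral_fun_snd]
    simp
  simp only [← sub_eq_add_neg] at e1
  rw [variance_fun_neg, variance_of_integral_eq_zero h3.aemeasurable e2] at e1
  rw [← ofReal_integral_eq_lintegral_ofReal h3.integrable_sq
    (Filter.Eventually.of_forall fun _ => sq_nonneg _), e1, ← ofReal_variance hf, ← two_mul,
    ENNReal.ofReal_mul zero_le_two, ENNReal.ofReal_ofNat]

theorem memLp_two_of_lintegral_sub_sq_lt_top {g : ℝ → ℝ} (hg : Continuous g)
    (h : ∫⁻ z : ℝ × ℝ, ENNReal.ofReal ((g z.1 - g z.2) ^ 2) ∂(ν.prod ν) < ∞) : MemLp g 2 ν := by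
  have hm : Measurable (fun z : ℝ × ℝ => ENNReal.ofReal ((g z.1 - g z.2) ^ 2)) := by
    have := hg.measurable
    fun_prop
  rw [lintegral_prod_symm _ hm.aemeasurable] at h
  have hae := ae_lt_top (Measurable.lintegral_prod_left' hm) h.ne
  obtain ⟨y, hy⟩ := hae.exists
  have h1 : MemLp (fun x => g x - g y) 2 ν := by
    rw [memLp_two_iff_integrable_sq (by fun_prop)]
    refine ⟨by fun_prop, ?_⟩
    rw [hasFiniteIntegral_iff_ofReal (Filter.Eventually.of_forall fun _ => sq_nonneg _)]
    exact hy
  have h2 := h1.add (memLp_const (g y))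
  have e : (fun x => g x - g y) + (fun _ => g y) = g := by
    funext x
    simp
  rwa [e] at h2

/-- An absolutely continuous function is the limit of the primitives of the truncations of its
derivative. -/
theorem IsAbsCont.exists_primitive_approx {g : ℝ → ℝ} (hg : IsAbsCont g) :
    ∃ h : ℕ → ℝ → ℝ, (∀ k, BddMeas (h k)) ∧ (∀ k x, h k x ^ 2 ≤ deriv g x ^ 2) ∧
      ∀ x, Filter.Tendsto (fun k => primitive (h k) x) Filter.atTop (nhds (g x - g 0)) := by
  have hms : ∀ k : ℕ, MeasurableSet {x | |deriv g x| ≤ k} := fun k =>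
    measurableSet_le (measurable_deriv g).abs measurable_const
  have hle : ∀ (k : ℕ) x, |({x | |deriv g x| ≤ k}.indicator (deriv g)) x| ≤ |deriv g x| :=
    fun k x => by
      by_cases hx : x ∈ {x | |deriv g x| ≤ k}
      · rw [Set.indicator_of_mem hx]
      · rw [Set.indicator_of_notMem hx, abs_zero]
        exact abs_nonneg _
  refine ⟨fun k => {x | |deriv g x| ≤ k}.indicator (deriv g), fun k => ⟨?_, k, fun x => ?_⟩,
    fun k x => sq_le_sq.2 (hle k x), fun x => ?_⟩
  · exact (measurable_deriv g).indicator (hms k)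
  · change |({x | |deriv g x| ≤ k}.indicator (deriv g)) x| ≤ k
    by_cases hx : x ∈ {x | |deriv g x| ≤ k}
    · rw [Set.indicator_of_mem hx]
      exact hx
    · rw [Set.indicator_of_notMem hx, abs_zero]
      positivity
  · rw [← (hg 0 x).integral_deriv_eq_sub]
    refine intervalIntegral.tendsto_integral_filter_of_dominated_convergence
      (fun t => |deriv g t|) ?_ ?_ ?_ ?_
    · exact Filter.Eventually.of_forall fun k =>
        ((measurable_deriv g).indicator (hms k)).aestronglyMeasurable
    · exact Filter.Eventually.of_forall fun k =>
        Filter.Eventually.of_forall fun t _ => hle k t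
    · exact (hg 0 x).intervalIntegrable_deriv.abs
    · refine Filter.Eventually.of_forall fun t _ => ?_
      refine tendsto_const_nhds.congr' ?_
      filter_upwards [Filter.eventually_ge_atTop ⌈|deriv g t|⌉₊] with k hk
      rw [Set.indicator_of_mem]
      exact (Nat.le_ceil _).trans (Nat.cast_le.2 hk)

theorem poincareConst_le_of_poincareIneq (hν : MemLp id 2 ν) (hP : PoincareIneq ν c) :
    poincareConst ν ≤ ENNReal.ofReal c := by
  have hc : 0 ≤ c := (variance_nonneg _ _).trans hP.variance_id_le
  refine iSup₂_le fun g hg => ?_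
  obtain ⟨hac, -, hd⟩ := hg
  set D := ∫⁻ y, ENNReal.ofReal ((deriv g y) ^ 2) ∂ν with hD
  obtain ⟨h, hb, hle, hlim⟩ := hac.exists_primitive_approx
  have hk : ∀ k, ∫⁻ z : ℝ × ℝ,
      ENNReal.ofReal ((primitive (h k) z.1 - primitive (h k) z.2) ^ 2) ∂(ν.prod ν)
        ≤ 2 * (ENNReal.ofReal c * D) := fun k => by
    rw [lintegral_sub_sq_eq ((hb k).memLp_primitive hν)]
    gcongr
    rw [← ofReal_variance ((hb k).memLp_primitive hν)]
    calc ENNReal.ofReal Var[primitive (h k); ν]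
        ≤ ENNReal.ofReal (c * ∫ x, h k x ^ 2 ∂ν) := ENNReal.ofReal_le_ofReal (hP _ (hb k))
      _ = ENNReal.ofReal c * ∫⁻ x, ENNReal.ofReal (h k x ^ 2) ∂ν := by
          rw [ENNReal.ofReal_mul hc, (hb k).lintegral_sq]
      _ ≤ ENNReal.ofReal c * D := by
          gcongr
          exact lintegral_mono fun x => ENNReal.ofReal_le_ofReal (hle k x)
  have hfatou : ∫⁻ z : ℝ × ℝ, ENNReal.ofReal ((g z.1 - g z.2) ^ 2) ∂(ν.prod ν)
      ≤ 2 * (ENNReal.ofReal c * D) := by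
    have hpt : ∀ z : ℝ × ℝ, ENNReal.ofReal ((g z.1 - g z.2) ^ 2)
        = Filter.liminf (fun k => ENNReal.ofReal
          ((primitive (h k) z.1 - primitive (h k) z.2) ^ 2)) Filter.atTop := fun z => by
      refine (Filter.Tendsto.liminf_eq ?_).symm
      have := (((hlim z.1).sub (hlim z.2)).pow 2)
      rw [sub_sub_sub_cancel_right] at this
      exact (ENNReal.continuous_ofReal.tendsto _).comp this
    simp_rw [hpt]
    refine (lintegral_liminf_le fun k => ?_).trans ?_
    · have := (hb k).continuous_primitive.measurable
      fun_prop
    · exact (Filter.liminf_le_liminf (Filter.Eventually.of_forall hk)).trans_eq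
        (Filter.liminf_const _)
  have hmem : MemLp g 2 ν := memLp_two_of_lintegral_sub_sq_lt_top hac.continuous
    (hfatou.trans_lt (ENNReal.mul_lt_top (by simp) (ENNReal.mul_lt_top (by simp) hd)))
  rw [lintegral_sub_sq_eq hmem, ENNReal.mul_le_mul_iff_right (by simp) (by simp)] at hfatou
  exact ENNReal.div_le_of_le_mul hfatou

end Transfer

theorem PoincareIneq.map_div {ν : Measure ℝ} {c : ℝ} (hP : PoincareIneq ν c) {r : ℝ} (hr : r ≠ 0) :
    PoincareIneq (ν.map (fun x => x / r)) (c / r ^ 2) := fun h hh => by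
  have hb : BddMeas (fun x => h (x / r) / r) := by
    obtain ⟨M, hM⟩ := hh.bounded
    refine ⟨(hh.measurable.comp (measurable_id.div_const r)).div_const r, M / |r|, fun x => ?_⟩
    rw [abs_div]
    exact div_le_div_of_nonneg_right (hM _) (abs_nonneg r)
  have e : ∀ x, primitive h (x / r) = primitive (fun t => h (t / r) / r) x := fun x => by
    unfold primitive
    rw [intervalIntegral.integral_div, intervalIntegral.integral_comp_div _ hr, zero_div,
      smul_eq_mul, mul_div_cancel_left₀ _ hr]
  have hm : Measurable (fun x : ℝ => x / r) := measurable_id.div_const r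
  rw [variance_map hh.continuous_primitive.aemeasurable hm.aemeasurable,
    integral_map hm.aemeasurable (hh.measurable.pow_const 2).aestronglyMeasurable]
  have h1 := hP _ hb
  simp only [div_pow, integral_div] at h1
  have h2 : primitive h ∘ (fun x => x / r) = primitive (fun t => h (t / r) / r) := funext e
  rw [h2]
  refine h1.trans_eq ?_
  ring

/-! ### Fisher information bounds the variance from below -/

namespace IsRegularDensity

variable {ν : Measure ℝ} {p : ℝ → ℝ}

theorem absolutelyContinuous (hp : IsRegularDensity ν p) : ν ≪ volume := by
  rw [hp.eq_withDensity]
  exact withDensity_absolutelyContinuous _ _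

theorem measurable_ofReal (hp : IsRegularDensity ν p) :
    Measurable (fun x => ENNReal.ofReal (p x)) :=
  hp.absCont.continuous.measurable.ennreal_ofReal

/-- The total variation of a regular density is the first absolute moment of the score. Zeros of
the density are minima, where its derivative vanishes. -/
theorem lintegral_abs_deriv (hp : IsRegularDensity ν p) :
    ∫⁻ x, ENNReal.ofReal |deriv p x| = ∫⁻ x, ENNReal.ofReal |deriv p x / p x| ∂ν := by
  have hq : Measurable (fun x => ENNReal.ofReal |deriv p x / p x|) :=
    ((measurable_deriv p).div hp.absCont.continuous.measurable).abs.ennreal_ofReal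
  conv_rhs => rw [hp.eq_withDensity]
  rw [lintegral_withDensity_eq_lintegral_mul _ hp.measurable_ofReal hq]
  refine lintegral_congr fun x => ?_
  rw [Pi.mul_apply, ← ENNReal.ofReal_mul (hp.nonneg x)]
  congr 1
  rcases (hp.nonneg x).eq_or_lt with h0 | h0
  · have hmin : IsLocalMin p x := Filter.Eventually.of_forall fun y => by
      rw [← h0]
      exact hp.nonneg y
    rw [hmin.deriv_eq_zero]
    simp
  · rw [abs_div, abs_of_pos h0, mul_div_cancel₀ _ h0.ne']

/-- A density is at most `1` somewhere, and varies by at most the first absolute moment of the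
score; so a bound on the Fisher information bounds the density. -/
theorem le_of_lintegral_score_sq_le [IsProbabilityMeasure ν] (hp : IsRegularDensity ν p) {J : ℝ}
    (hJ : 0 ≤ J) (h : ∫⁻ y, ENNReal.ofReal ((deriv p y / p y) ^ 2) ∂ν ≤ ENNReal.ofReal J)
    (x : ℝ) : p x ≤ J + 2 := by
  have hL : ∫⁻ x, ENNReal.ofReal |deriv p x| ≤ ENNReal.ofReal (J + 1) := by
    rw [hp.lintegral_abs_deriv]
    calc ∫⁻ x, ENNReal.ofReal |deriv p x / p x| ∂ν
        ≤ ∫⁻ x, (ENNReal.ofReal ((deriv p x / p x) ^ 2) + 1) ∂ν := by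
          refine lintegral_mono fun x => ?_
          rw [← ENNReal.ofReal_one, ← ENNReal.ofReal_add (sq_nonneg _) zero_le_one]
          refine ENNReal.ofReal_le_ofReal ?_
          nlinarith [sq_abs (deriv p x / p x), sq_nonneg (|deriv p x / p x| - 1),
            abs_nonneg (deriv p x / p x)]
      _ ≤ ENNReal.ofReal (J + 1) := by
          rw [lintegral_add_right _ measurable_const, lintegral_const, measure_univ, one_mul,
            ENNReal.ofReal_add hJ zero_le_one, ENNReal.ofReal_one]
          gcongr
  have hint : Integrable (fun x => |deriv p x|) := by
    refine ⟨(measurable_deriv p).abs.aestronglyMeasurable, ?_⟩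
    rw [hasFiniteIntegral_iff_ofReal (Filter.Eventually.of_forall fun _ => abs_nonneg _)]
    exact hL.trans_lt ENNReal.ofReal_lt_top
  have hLr : ∫ x, |deriv p x| ≤ J + 1 := by
    rw [integral_eq_lintegral_of_nonneg_ae (Filter.Eventually.of_forall fun _ => abs_nonneg _)
      (measurable_deriv p).abs.aestronglyMeasurable]
    exact ENNReal.toReal_le_of_le_ofReal (by linarith) hL
  -- a probability density is at most `1` somewhere
  obtain ⟨y, hy⟩ : ∃ y, p y ≤ 1 := by
    by_contra! hcon
    have h1 : ν Set.univ = ∫⁻ x, ENNReal.ofReal (p x) := by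
      rw [hp.eq_withDensity, withDensity_apply _ MeasurableSet.univ, setLIntegral_univ]
    have h2 : ∫⁻ _ : ℝ, (1 : ℝ≥0∞) ≤ ∫⁻ x, ENNReal.ofReal (p x) := lintegral_mono fun x => by
      rw [← ENNReal.ofReal_one]
      exact ENNReal.ofReal_le_ofReal (hcon x).le
    rw [← h1, measure_univ] at h2
    simp at h2
  have h3 : p x - p y ≤ ∫ t, |deriv p t| := by
    rw [← (hp.absCont y x).integral_deriv_eq_sub]
    calc ∫ t in y..x, deriv p t ≤ ‖∫ t in y..x, deriv p t‖ := Real.le_norm_self _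
      _ ≤ ∫ t in Set.uIoc y x, ‖deriv p t‖ := intervalIntegral.norm_integral_le_integral_norm_uIoc
      _ ≤ ∫ t, |deriv p t| := setIntegral_le_integral hint
          (Filter.Eventually.of_forall fun _ => abs_nonneg _)
  linarith

/-- A law with density bounded by `M` has probability at most `1/2` on the interval of length
`1/(2M)` about its mean, so Chebyshev's inequality bounds its variance from below. -/
theorem one_le_mul_variance [IsProbabilityMeasure ν] (hp : IsRegularDensity ν p)
    (hν : MemLp id 2 ν) {M : ℝ} (hM : 0 < M) (h : ∀ x, p x ≤ M) :
    1 ≤ 32 * M ^ 2 * Var[id; ν] := by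
  set m := ∫ x, id x ∂ν with hm
  set δ : ℝ := 1 / (4 * M) with hδ
  have hδ0 : 0 < δ := by positivity
  have h1 : ν {x | |x - m| < δ} ≤ ENNReal.ofReal (1 / 2) := by
    have hs : {x | |x - m| < δ} = Metric.ball m δ := by
      ext x
      simp [Real.dist_eq]
    rw [hs, hp.eq_withDensity, withDensity_apply _ Metric.isOpen_ball.measurableSet]
    calc ∫⁻ x in Metric.ball m δ, ENNReal.ofReal (p x)
        ≤ ∫⁻ _ in Metric.ball m δ, ENNReal.ofReal M :=
          lintegral_mono fun x => ENNReal.ofReal_le_ofReal (h x)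
      _ = ENNReal.ofReal (1 / 2) := by
          rw [setLIntegral_const, Real.volume_ball, ← ENNReal.ofReal_mul hM.le, hδ]
          congr 1
          field_simp
          norm_num
  have h2 : ν {x | δ ≤ |x - m|} ≤ ENNReal.ofReal (Var[id; ν] / δ ^ 2) :=
    meas_ge_le_variance_div_sq hν hδ0
  have h3 : ν Set.univ ≤ ν {x | |x - m| < δ} + ν {x | δ ≤ |x - m|} := by
    refine (measure_mono fun x _ => ?_).trans (measure_union_le _ _)
    exact lt_or_ge |x - m| δ
  have hv : 0 ≤ Var[id; ν] := variance_nonneg _ _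
  rw [measure_univ] at h3
  have h4 : ENNReal.ofReal 1 ≤ ENNReal.ofReal (1 / 2 + Var[id; ν] / δ ^ 2) := by
    rw [ENNReal.ofReal_one, ENNReal.ofReal_add (by norm_num) (by positivity)]
    exact h3.trans (add_le_add h1 h2)
  rw [ENNReal.ofReal_le_ofReal_iff (by positivity)] at h4
  have h5 : Var[id; ν] / δ ^ 2 = 16 * M ^ 2 * Var[id; ν] := by
    rw [hδ]
    field_simp
    norm_num
  rw [h5] at h4
  linarith

end IsRegularDensity

theorem exists_isRegularDensity_of_fisherInfo_lt {ν : Measure ℝ} {J : ℝ≥0∞}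
    (h : fisherInfo ν < J) : ∃ p, IsRegularDensity ν p ∧
      ∫⁻ y, ENNReal.ofReal ((deriv p y / p y) ^ 2) ∂ν < J := by
  simpa only [fisherInfo, iInf_lt_iff, exists_prop] using h

/-! ### A Poincaré inequality for densities with exponentially decaying ratios -/

theorem integrable_exp_neg_abs : Integrable (fun t : ℝ => Real.exp (-|t|)) := by
  refine (integrable_inv_one_add_sq.const_mul 2).mono (by fun_prop)
    (Filter.Eventually.of_forall fun t => ?_)
  rw [Real.norm_of_nonneg (Real.exp_pos _).le, Real.norm_of_nonneg (by positivity), Real.exp_neg,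
    ← div_eq_mul_inv, inv_eq_one_div, div_le_div_iff₀ (Real.exp_pos _) (by positivity)]
  have := Real.quadratic_le_exp_of_nonneg (abs_nonneg t)
  rw [sq_abs] at this
  nlinarith [abs_nonneg t]

theorem sq_lintegral_mul_le {α : Type*} [MeasurableSpace α] (μ : Measure α) {f g : α → ℝ≥0∞}
    (hf : AEMeasurable f μ) (hg : AEMeasurable g μ) :
    (∫⁻ a, f a * g a ∂μ) ^ 2 ≤ (∫⁻ a, f a ^ 2 ∂μ) * ∫⁻ a, g a ^ 2 ∂μ := by
  have h := ENNReal.lintegral_mul_le_Lp_mul_Lq μ Real.HolderConjugate.two_two hf hg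
  simp only [Pi.mul_apply, ENNReal.rpow_two] at h
  have hs : ∀ x : ℝ≥0∞, (x ^ (1 / 2 : ℝ)) ^ 2 = x := fun x => by
    rw [← ENNReal.rpow_two, ← ENNReal.rpow_mul]
    norm_num
  calc (∫⁻ a, f a * g a ∂μ) ^ 2
      ≤ ((∫⁻ a, f a ^ 2 ∂μ) ^ (1 / 2 : ℝ) * (∫⁻ a, g a ^ 2 ∂μ) ^ (1 / 2 : ℝ)) ^ 2 := by gcongr
    _ = _ := by rw [mul_pow, hs, hs]

/-- If `p x ≤ e^{2a - 2|x - s|} p s` whenever `s` lies between `0` and `x`, then the law with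
density `p` satisfies a Poincaré inequality: by Cauchy–Schwarz with the weight `e^{|x - s|}`,
the square of `∫_0^x h` times `p x` is at most a convolution of `h² p` with `e^{-|·|}`. -/
theorem exists_poincareIneq_of_density {ν : Measure ℝ} [IsProbabilityMeasure ν]
    (hν : MemLp id 2 ν) {p : ℝ → ℝ} (hp : Measurable p)
    (hνp : ν = volume.withDensity (fun x => ENNReal.ofReal (p x))) {a : ℝ}
    (h : ∀ x, ∀ s ∈ Set.uIoc 0 x, p x ≤ Real.exp (2 * a - 2 * |x - s|) * p s) :
    ∃ c, PoincareIneq ν c := by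
  have hpm : Measurable (fun x => ENNReal.ofReal (p x)) := hp.ennreal_ofReal
  set κ : ℝ → ℝ≥0∞ := fun t => ENNReal.ofReal (Real.exp (-|t|)) with hκ
  have hκm : Measurable κ := by fun_prop
  set K : ℝ≥0∞ := ∫⁻ t, κ t with hK
  have hKtop : K ≠ ∞ := by
    have := integrable_exp_neg_abs.lintegral_lt_top
    exact this.ne
  have hshift : ∀ x, ∫⁻ s, κ (x - s) = K := fun x => lintegral_sub_left_eq_self κ x
  have hshift' : ∀ s, ∫⁻ x, κ (x - s) = K := fun s => lintegral_sub_right_eq_self κ s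
  set A : ℝ≥0∞ := ENNReal.ofReal (Real.exp (2 * a)) with hA
  refine ⟨(K * (A * K)).toReal, fun f hf => ?_⟩
  have hfm : Measurable (fun s => ‖f s‖ₑ) := hf.measurable.enorm
  have hpt : ∀ x, ‖primitive f x‖ₑ ^ 2 * ENNReal.ofReal (p x)
      ≤ K * (A * ∫⁻ s, ‖f s‖ₑ ^ 2 * (κ (x - s) * ENNReal.ofReal (p s))) := fun x => by
    have h1 : ‖primitive f x‖ₑ ≤ ∫⁻ s in Set.uIoc 0 x, ‖f s‖ₑ := by
      have : ‖primitive f x‖ₑ = ‖∫ s in Set.uIoc 0 x, f s‖ₑ := by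
        rw [← ofReal_norm, ← ofReal_norm]
        unfold primitive
        rw [intervalIntegral.norm_intervalIntegral_eq]
      rw [this]
      exact enorm_integral_le_lintegral_enorm _
    have h2 : ∫⁻ s in Set.uIoc 0 x, ‖f s‖ₑ
        = ∫⁻ s in Set.uIoc 0 x, (‖f s‖ₑ * ENNReal.ofReal (Real.exp (|x - s| / 2)))
          * ENNReal.ofReal (Real.exp (-|x - s| / 2)) := by
      refine lintegral_congr fun s => ?_
      rw [mul_assoc, ← ENNReal.ofReal_mul (Real.exp_pos _).le, ← Real.exp_add]
      simp [neg_div]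
    have h3 := sq_lintegral_mul_le (volume.restrict (Set.uIoc 0 x))
      (f := fun s => ‖f s‖ₑ * ENNReal.ofReal (Real.exp (|x - s| / 2)))
      (g := fun s => ENNReal.ofReal (Real.exp (-|x - s| / 2)))
      (by fun_prop) (by fun_prop)
    have h4 : ∫⁻ s in Set.uIoc 0 x, ENNReal.ofReal (Real.exp (-|x - s| / 2)) ^ 2 ≤ K := by
      rw [← hshift x]
      refine (setLIntegral_le_lintegral _ _).trans_eq (lintegral_congr fun s => ?_)
      rw [← ENNReal.ofReal_pow (Real.exp_pos _).le, ← Real.exp_nat_mul, hκ]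
      congr 2
      push_cast
      ring
    have h5 : (∫⁻ s in Set.uIoc 0 x, (‖f s‖ₑ * ENNReal.ofReal (Real.exp (|x - s| / 2))) ^ 2)
        * ENNReal.ofReal (p x)
          ≤ A * ∫⁻ s, ‖f s‖ₑ ^ 2 * (κ (x - s) * ENNReal.ofReal (p s)) := by
      rw [← lintegral_mul_const _ (by fun_prop), ← lintegral_const_mul _ (by fun_prop)]
      refine (setLIntegral_mono' measurableSet_uIoc fun s hs => ?_).trans
        (setLIntegral_le_lintegral _ _)
      rw [mul_pow, mul_assoc, mul_left_comm A]
      refine mul_le_mul_right ?_ _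
      rw [← ENNReal.ofReal_pow (Real.exp_pos _).le, ← ENNReal.ofReal_mul (by positivity), hκ,
        hA, ← ENNReal.ofReal_mul (by positivity), ← ENNReal.ofReal_mul (by positivity)]
      refine ENNReal.ofReal_le_ofReal ?_
      rw [← Real.exp_nat_mul]
      calc Real.exp ((2 : ℕ) * (|x - s| / 2)) * p x
          ≤ Real.exp ((2 : ℕ) * (|x - s| / 2)) * (Real.exp (2 * a - 2 * |x - s|) * p s) :=
            mul_le_mul_of_nonneg_left (h x s hs) (Real.exp_pos _).le
        _ = Real.exp (2 * a) * (Real.exp (-|x - s|) * p s) := by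
            rw [← mul_assoc, ← mul_assoc, ← Real.exp_add, ← Real.exp_add]
            congr 2
            push_cast
            ring
    calc ‖primitive f x‖ₑ ^ 2 * ENNReal.ofReal (p x)
        ≤ ((∫⁻ s in Set.uIoc 0 x, (‖f s‖ₑ * ENNReal.ofReal (Real.exp (|x - s| / 2))) ^ 2) * K)
          * ENNReal.ofReal (p x) := by
          gcongr
          calc ‖primitive f x‖ₑ ^ 2 ≤ (∫⁻ s in Set.uIoc 0 x, ‖f s‖ₑ) ^ 2 := by gcongr
            _ ≤ _ := by
              rw [h2]
              exact h3.trans (by gcongr)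
      _ = K * ((∫⁻ s in Set.uIoc 0 x, (‖f s‖ₑ * ENNReal.ofReal (Real.exp (|x - s| / 2))) ^ 2)
          * ENNReal.ofReal (p x)) := by ring
      _ ≤ _ := by gcongr
  have hint : ∫⁻ x, ‖primitive f x‖ₑ ^ 2 ∂ν ≤ (K * (A * K)) * ∫⁻ x, ‖f x‖ₑ ^ 2 ∂ν := by
    have hpr := hf.continuous_primitive.measurable
    rw [hνp, lintegral_withDensity_eq_lintegral_mul _ hpm (by fun_prop),
      lintegral_withDensity_eq_lintegral_mul _ hpm (by fun_prop)]
    simp only [Pi.mul_apply]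
    calc ∫⁻ x, ENNReal.ofReal (p x) * ‖primitive f x‖ₑ ^ 2
        ≤ ∫⁻ x, K * (A * ∫⁻ s, ‖f s‖ₑ ^ 2 * (κ (x - s) * ENNReal.ofReal (p s))) :=
          lintegral_mono fun x => by
            rw [mul_comm]
            exact hpt x
      _ = K * (A * ∫⁻ s, ∫⁻ x, ‖f s‖ₑ ^ 2 * (κ (x - s) * ENNReal.ofReal (p s))) := by
          have hm2 : Measurable (Function.uncurry fun x s : ℝ =>
              ‖f s‖ₑ ^ 2 * (κ (x - s) * ENNReal.ofReal (p s))) := by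
            have := hf.measurable
            fun_prop
          have hm3 : Measurable (fun x => ∫⁻ s, ‖f s‖ₑ ^ 2 * (κ (x - s) * ENNReal.ofReal (p s))) :=
            hm2.lintegral_prod_right'
          rw [lintegral_const_mul _ (hm3.const_mul A), lintegral_const_mul _ hm3,
            lintegral_lintegral_swap hm2.aemeasurable]
      _ = K * (A * ∫⁻ s, K * (ENNReal.ofReal (p s) * ‖f s‖ₑ ^ 2)) := by
          congr 2
          refine lintegral_congr fun s => ?_
          rw [lintegral_const_mul _ (by fun_prop), lintegral_mul_const _ (by fun_prop), hshift']
          ring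
      _ = (K * (A * K)) * ∫⁻ s, ENNReal.ofReal (p s) * ‖f s‖ₑ ^ 2 := by
          rw [lintegral_const_mul _ (by fun_prop)]
          ring
  have hsq : ∀ g : ℝ → ℝ, MemLp g 2 ν →
      ∫⁻ x, ‖g x‖ₑ ^ 2 ∂ν = ENNReal.ofReal (∫ x, g x ^ 2 ∂ν) := fun g hg => by
    rw [ofReal_integral_eq_lintegral_ofReal hg.integrable_sq
      (Filter.Eventually.of_forall fun _ => sq_nonneg _)]
    refine lintegral_congr fun x => ?_
    rw [← ofReal_norm, ← ENNReal.ofReal_pow (norm_nonneg _), Real.norm_eq_abs, sq_abs]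
  have hCtop : K * (A * K) ≠ ∞ :=
    ENNReal.mul_ne_top hKtop (ENNReal.mul_ne_top ENNReal.ofReal_ne_top hKtop)
  rw [hsq _ (hf.memLp_primitive hν), hsq _ (hf.memLp 2 ν), ← ENNReal.ofReal_toReal hCtop,
    ← ENNReal.ofReal_mul ENNReal.toReal_nonneg, ENNReal.ofReal_le_ofReal_iff
      (mul_nonneg ENNReal.toReal_nonneg (integral_nonneg fun _ => sq_nonneg _))] at hint
  exact (variance_le_expectation_sq hf.continuous_primitive.aestronglyMeasurable).trans hint

/-! ### The third moment as an obstruction -/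

theorem integrable_pow_of_memLp {ν : Measure ℝ} [IsFiniteMeasure ν] {k p : ℕ}
    (h : MemLp id p ν) (hk : k ≤ p) : Integrable (fun x : ℝ => x ^ k) ν := by
  have h1 : MemLp id (k : ℝ≥0∞) ν := h.mono_exponent (by exact_mod_cast hk)
  refine (h1.integrable_norm_pow').mono (by fun_prop) (Filter.Eventually.of_forall fun x => ?_)
  simp

theorem integral_id_conv {μ ν : Measure ℝ} [IsProbabilityMeasure μ] [IsProbabilityMeasure ν]
    (hμ : MemLp id 4 μ) (hν : MemLp id 4 ν) :
    ∫ x, x ∂(μ ∗ ν) = ∫ x, x ∂μ + ∫ x, x ∂ν := by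
  have i1 : Integrable (fun x : ℝ => x) μ := by
    simpa using integrable_pow_of_memLp (p := 4) (k := 1) hμ (by norm_num)
  have i2 : Integrable (fun x : ℝ => x) ν := by
    simpa using integrable_pow_of_memLp (p := 4) (k := 1) hν (by norm_num)
  have e : ∫ x, x ∂(μ ∗ ν) = ∫ z : ℝ × ℝ, (z.1 + z.2) ∂(μ.prod ν) :=
    integral_map (by fun_prop) (by fun_prop)
  rw [e, integral_add (i1.comp_fst ν) (i2.comp_snd μ), integral_fun_fst (fun x : ℝ => x),
    integral_fun_snd (fun x : ℝ => x)]
  simp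

theorem integral_cube_conv {μ ν : Measure ℝ} [IsProbabilityMeasure μ] [IsProbabilityMeasure ν]
    (hμ : MemLp id 4 μ) (hν : MemLp id 4 ν) (hμ0 : ∫ x, x ∂μ = 0) (hν0 : ∫ x, x ∂ν = 0) :
    ∫ x, x ^ 3 ∂(μ ∗ ν) = ∫ x, x ^ 3 ∂μ + ∫ x, x ^ 3 ∂ν := by
  have iμ : ∀ k ≤ 4, Integrable (fun x : ℝ => x ^ k) μ :=
    fun k hk => integrable_pow_of_memLp (p := 4) hμ hk
  have iν : ∀ k ≤ 4, Integrable (fun x : ℝ => x ^ k) ν :=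
    fun k hk => integrable_pow_of_memLp (p := 4) hν hk
  have e : ∫ x, x ^ 3 ∂(μ ∗ ν) = ∫ z : ℝ × ℝ, (z.1 + z.2) ^ 3 ∂(μ.prod ν) :=
    integral_map (by fun_prop) (by fun_prop)
  have e2 : ∀ z : ℝ × ℝ, (z.1 + z.2) ^ 3
      = z.1 ^ 3 + (3 * (z.1 ^ 2 * z.2 ^ 1) + (3 * (z.1 ^ 1 * z.2 ^ 2) + z.2 ^ 3)) :=
    fun z => by ring
  have j1 : Integrable (fun z : ℝ × ℝ => z.1 ^ 3) (μ.prod ν) := (iμ 3 (by norm_num)).comp_fst ν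
  have j2 : Integrable (fun z : ℝ × ℝ => 3 * (z.1 ^ 2 * z.2 ^ 1)) (μ.prod ν) :=
    ((iμ 2 (by norm_num)).mul_prod (iν 1 (by norm_num))).const_mul 3
  have j3 : Integrable (fun z : ℝ × ℝ => 3 * (z.1 ^ 1 * z.2 ^ 2)) (μ.prod ν) :=
    ((iμ 1 (by norm_num)).mul_prod (iν 2 (by norm_num))).const_mul 3
  have j4 : Integrable (fun z : ℝ × ℝ => z.2 ^ 3) (μ.prod ν) := (iν 3 (by norm_num)).comp_snd μ
  have j34 : Integrable (fun z : ℝ × ℝ => 3 * (z.1 ^ 1 * z.2 ^ 2) + z.2 ^ 3) (μ.prod ν) :=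
    j3.add j4
  have j234 : Integrable (fun z : ℝ × ℝ => 3 * (z.1 ^ 2 * z.2 ^ 1)
      + (3 * (z.1 ^ 1 * z.2 ^ 2) + z.2 ^ 3)) (μ.prod ν) := j2.add j34
  simp_rw [e, e2]
  rw [integral_add j1 j234, integral_add j2 j34, integral_add j3 j4, integral_const_mul,
    integral_const_mul, integral_prod_mul (fun x : ℝ => x ^ 2) (fun x : ℝ => x ^ 1),
    integral_prod_mul (fun x : ℝ => x ^ 1) (fun x : ℝ => x ^ 2),
    integral_fun_fst (fun x : ℝ => x ^ 3), integral_fun_snd (fun x : ℝ => x ^ 3)]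
  simp [hμ0, hν0]

theorem integral_id_and_cube_convPow {μ : Measure ℝ} [IsProbabilityMeasure μ] (hμ : MemLp id 4 μ)
    (h0 : ∫ x, x ∂μ = 0) (n : ℕ) :
    ∫ x, x ∂(convPow μ n) = 0 ∧ ∫ x, x ^ 3 ∂(convPow μ n) = n * ∫ x, x ^ 3 ∂μ := by
  induction n with
  | zero => simp [convPow]
  | succ n ih =>
    have h4 : MemLp id 4 (convPow μ n) := memLp_id_convPow hμ n
    rw [convPow, integral_id_conv h4 hμ, integral_cube_conv h4 hμ ih.1 h0, ih.1, ih.2, h0]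
    refine ⟨by ring, ?_⟩
    push_cast
    ring

/-- A standardized law with third moment `τ` has Poincaré constant at least
`1 + (τ²/4) / (1 + τ²/4)`. The test function is `x + (τ/4) x²`: its variance exceeds `1` by at
least `2 (τ/4) τ`, twice as much as the mean of its squared derivative does. -/
theorem le_poincareConst_of_third_moment {ν : Measure ℝ} [IsProbabilityMeasure ν]
    (hν : MemLp id 4 ν) (h0 : ∫ x, x ∂ν = 0) (h1 : Var[id; ν] = 1) {τ : ℝ}
    (hτ : ∫ x, x ^ 3 ∂ν = τ) (hR : poincareConst ν < ∞) :
    (τ ^ 2 / 4) / (1 + τ ^ 2 / 4) ≤ (poincareConst ν).toReal - 1 := by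
  have ipow : ∀ k ≤ 4, Integrable (fun x : ℝ => x ^ k) ν :=
    fun k hk => integrable_pow_of_memLp (p := 4) hν hk
  have hν2 : MemLp id 2 ν := hν.mono_exponent (by norm_num)
  have hsq : MemLp (fun x : ℝ => x ^ 2) 2 ν := by
    rw [memLp_two_iff_integrable_sq (by fun_prop)]
    simpa only [← pow_mul] using ipow 4 le_rfl
  have hm2 : ∫ x, x ^ 2 ∂ν = 1 := by
    rw [← h1, variance_of_integral_eq_zero aemeasurable_id h0]
    rfl
  set β := τ / 4 with hβ
  set g : ℝ → ℝ := id + β • (fun x : ℝ => x ^ 2) with hg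
  have hgm : MemLp g 2 ν := hν2.add (hsq.const_smul β)
  have hderiv : ∀ x, deriv g x = 1 + 2 * β * x := fun x => by
    have h2 := (hasDerivAt_id x).add ((hasDerivAt_pow 2 x).const_smul β)
    rw [hg, h2.deriv]
    simp only [smul_eq_mul]
    push_cast
    ring
  have hac : IsAbsCont g := fun a b => by
    have hc : ContDiff ℝ 1 g := by
      rw [hg]
      exact contDiff_id.add (contDiff_const.smul (contDiff_id.pow 2))
    exact hc.contDiffOn.absolutelyContinuousOnInterval
  have hvar : 1 + 2 * β * τ ≤ Var[g; ν] := by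
    rw [hg, variance_add hν2 (hsq.const_smul β), h1, covariance_smul_right,
      covariance_eq_sub hν2 hsq]
    have e : ∫ x, ((id : ℝ → ℝ) * fun x : ℝ => x ^ 2) x ∂ν = τ := by
      rw [← hτ]
      refine integral_congr_ae (Filter.Eventually.of_forall fun x => ?_)
      simp only [Pi.mul_apply, id]
      ring
    have e0 : ∫ x, id x ∂ν = 0 := h0
    rw [e, e0]
    have := variance_nonneg (β • fun x : ℝ => x ^ 2) ν
    nlinarith
  have hden : ∫⁻ y, ENNReal.ofReal ((deriv g y) ^ 2) ∂ν = ENNReal.ofReal (1 + 4 * β ^ 2) := by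
    have e : ∀ y, (deriv g y) ^ 2 = 1 + (4 * β * y ^ 1 + 4 * β ^ 2 * y ^ 2) := fun y => by
      rw [hderiv]
      ring
    have j1 : Integrable (fun y : ℝ => 4 * β * y ^ 1) ν := (ipow 1 (by norm_num)).const_mul _
    have j2 : Integrable (fun y : ℝ => 4 * β ^ 2 * y ^ 2) ν := (ipow 2 (by norm_num)).const_mul _
    have j12 : Integrable (fun y : ℝ => 4 * β * y ^ 1 + 4 * β ^ 2 * y ^ 2) ν := j1.add j2
    have j : Integrable (fun y => (deriv g y) ^ 2) ν := by
      simp_rw [e]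
      exact (integrable_const 1).add j12
    rw [← ofReal_integral_eq_lintegral_ofReal j (Filter.Eventually.of_forall fun _ => sq_nonneg _)]
    simp_rw [e]
    rw [integral_add (integrable_const 1) j12, integral_add j1 j2, integral_const_mul,
      integral_const_mul, hm2]
    simp [h0]
  have hle := evariance_le_of_poincareConst_le hR.ne le_rfl hac
    (by rw [hden]; exact ENNReal.ofReal_lt_top)
  rw [hden, ← ofReal_variance hgm, ← ENNReal.ofReal_toReal hR.ne,
    ← ENNReal.ofReal_mul ENNReal.toReal_nonneg, ENNReal.ofReal_le_ofReal_iff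
      (mul_nonneg ENNReal.toReal_nonneg (by positivity))] at hle
  rw [div_le_iff₀ (by positivity)]
  have h3 := hvar.trans hle
  rw [hβ] at h3
  linarith

/-! ### Laws of normalized sums -/

section Sums

variable {Ω : Type*} [MeasurableSpace Ω] {P : Measure Ω} [IsProbabilityMeasure P] {X : ℕ → Ω → ℝ}

theorem IsIID.map_sum (hX : IsIID P X) (n : ℕ) :
    P.map (fun ω => ∑ i ∈ Finset.range n, X i ω) = convPow (P.map (X 0)) n := by
  induction n with
  | zero =>
    simp only [Finset.range_zero, Finset.sum_empty, Measure.map_const, measure_univ, one_smul]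
    rfl
  | succ n ih =>
    have hind : IndepFun (fun ω => ∑ i ∈ Finset.range n, X i ω) (X n) P := by
      have := hX.indep.indepFun_finsetSum_of_notMem hX.measurable
        (s := Finset.range n) (i := n) (by simp)
      convert this using 1
      funext ω
      simp
    have hm : Measurable (fun ω => ∑ i ∈ Finset.range n, X i ω) :=
      Finset.measurable_sum _ fun i _ => hX.measurable i
    have h1 := hind.map_add_eq_map_conv_map hm (hX.measurable n)
    rw [ih, (hX.identDistrib n).map_eq] at h1
    simp_rw [Finset.sum_range_succ]
    exact h1

theorem IsIID.map_normalizedSum (hX : IsIID P X) (n : ℕ) :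
    P.map (normalizedSum P X n)
      = (convPow (P.map (X 0)) n).map (fun x => x / √(n * Var[id; P.map (X 0)])) := by
  have hm : Measurable (fun ω => ∑ i ∈ Finset.range n, X i ω) :=
    Finset.measurable_sum _ fun i _ => hX.measurable i
  rw [variance_id_map (hX.measurable 0).aemeasurable, ← hX.map_sum,
    Measure.map_map (by fun_prop) hm]
  rfl

end Sums

/-! ### A skewed Gaussian mixture -/

/-- The centred two-point law on `-1` and `2`. -/
noncomputable def skewCoin : Measure ℝ :=
  ENNReal.ofReal (2 / 3) • Measure.dirac (-1) + ENNReal.ofReal (1 / 3) • Measure.dirac 2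

/-- The law of a standard Gaussian variable plus an independent skewed coin. -/
noncomputable def skewMixture : Measure ℝ := gaussianReal 0 1 ∗ skewCoin

/-- The density of `skewMixture`. -/
noncomputable def skewDensity (x : ℝ) : ℝ :=
  2 / 3 * gaussianPDFReal (-1) 1 x + 1 / 3 * gaussianPDFReal 2 1 x

instance isProbabilityMeasure_skewCoin : IsProbabilityMeasure skewCoin := by
  constructor
  simp only [skewCoin, Measure.coe_add, Measure.coe_smul, Pi.add_apply, Pi.smul_apply,
    measure_univ, smul_eq_mul, mul_one]
  rw [← ENNReal.ofReal_add (by norm_num) (by norm_num)]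
  norm_num

instance isProbabilityMeasure_skewMixture : IsProbabilityMeasure skewMixture :=
  inferInstanceAs (IsProbabilityMeasure (gaussianReal 0 1 ∗ skewCoin))

theorem integral_skewCoin (f : ℝ → ℝ) : ∫ x, f x ∂skewCoin = 2 / 3 * f (-1) + 1 / 3 * f 2 := by
  have hi : ∀ a c : ℝ, Integrable f (ENNReal.ofReal c • Measure.dirac a) := fun a c =>
    (integrable_dirac (by finiteness)).smul_measure ENNReal.ofReal_ne_top
  rw [skewCoin, integral_add_measure (hi _ _) (hi _ _), integral_smul_measure,
    integral_smul_measure, integral_dirac, integral_dirac, ENNReal.toReal_ofReal (by norm_num),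
    ENNReal.toReal_ofReal (by norm_num), smul_eq_mul, smul_eq_mul]

theorem memLp_id_skewCoin (p : ℝ≥0∞) : MemLp id p skewCoin := by
  refine MemLp.of_bound aestronglyMeasurable_id 2 ?_
  rw [skewCoin, ae_add_measure_iff]
  constructor <;> refine Measure.ae_smul_measure ?_ _ <;> rw [ae_dirac_eq]
  · change ‖(-1 : ℝ)‖ ≤ 2
    norm_num
  · change ‖(2 : ℝ)‖ ≤ 2
    norm_num

theorem integral_cube_gaussianReal : ∫ x, x ^ 3 ∂(gaussianReal 0 1) = 0 := by
  have h : ∫ x, x ^ 3 ∂((gaussianReal 0 1).map (fun x => -x)) = ∫ x, (-x) ^ 3 ∂(gaussianReal 0 1) :=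
    integral_map (by fun_prop) (by fun_prop)
  rw [gaussianReal_map_neg, neg_zero] at h
  simp only [Odd.neg_pow (by decide : Odd 3), integral_neg] at h
  linarith

theorem memLp_id_skewMixture (p : ℝ≥0) : MemLp id p skewMixture :=
  memLp_id_conv (memLp_id_gaussianReal p) (memLp_id_skewCoin p)

theorem integral_id_skewMixture : ∫ x, x ∂skewMixture = 0 := by
  rw [skewMixture, integral_id_conv (memLp_id_gaussianReal 4) (memLp_id_skewCoin 4),
    integral_id_gaussianReal, integral_skewCoin]
  norm_num

theorem integral_cube_skewMixture : ∫ x, x ^ 3 ∂skewMixture = 2 := by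
  rw [skewMixture, integral_cube_conv (memLp_id_gaussianReal 4) (memLp_id_skewCoin 4)
    integral_id_gaussianReal (by rw [integral_skewCoin]; norm_num), integral_cube_gaussianReal,
    integral_skewCoin]
  norm_num

theorem contDiff_gaussianPDFReal (m : ℝ) {n : WithTop ℕ∞} :
    ContDiff ℝ n (gaussianPDFReal m 1) := by
  unfold gaussianPDFReal
  fun_prop

theorem hasDerivAt_gaussianPDFReal (m x : ℝ) :
    HasDerivAt (gaussianPDFReal m 1) (-(x - m) * gaussianPDFReal m 1 x) x := by
  have h := (((((hasDerivAt_id x).sub_const m).pow 2).neg.div_const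
    (2 * ((1 : ℝ≥0) : ℝ))).exp).const_mul ((√(2 * Real.pi * ((1 : ℝ≥0) : ℝ)))⁻¹)
  refine h.congr_deriv ?_
  simp only [gaussianPDFReal, id, NNReal.coe_one, Pi.pow_apply, Pi.neg_apply]
  ring

theorem contDiff_skewDensity {n : WithTop ℕ∞} : ContDiff ℝ n skewDensity := by
  have h1 := contDiff_gaussianPDFReal (-1) (n := n)
  have h2 := contDiff_gaussianPDFReal 2 (n := n)
  unfold skewDensity
  fun_prop

theorem skewDensity_pos (x : ℝ) : 0 < skewDensity x := by
  have h1 := gaussianPDFReal_pos (-1) 1 x one_ne_zero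
  have h2 := gaussianPDFReal_pos 2 1 x one_ne_zero
  unfold skewDensity
  positivity

theorem skewMixture_eq_withDensity :
    skewMixture = volume.withDensity (fun x => ENNReal.ofReal (skewDensity x)) := by
  have e : (fun x => ENNReal.ofReal (skewDensity x))
      = ENNReal.ofReal (2 / 3) • gaussianPDF (-1) 1 + ENNReal.ofReal (1 / 3) • gaussianPDF 2 1 := by
    funext x
    have h1 := gaussianPDFReal_nonneg (-1) 1 x
    have h2 := gaussianPDFReal_nonneg 2 1 x
    simp only [skewDensity, Pi.add_apply, Pi.smul_apply, smul_eq_mul, gaussianPDF]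
    rw [ENNReal.ofReal_add (by positivity) (by positivity), ENNReal.ofReal_mul (by norm_num),
      ENNReal.ofReal_mul (by norm_num)]
  have hg1 := measurable_gaussianPDF (-1) 1
  have hg2 := measurable_gaussianPDF 2 1
  have hc : ∀ a : ℝ, gaussianReal 0 1 ∗ Measure.dirac a = gaussianReal a 1 := fun a => by
    rw [Measure.conv_dirac, gaussianReal_map_add_const, zero_add]
  have hs : ∀ (c : ℝ≥0∞) (a : ℝ), gaussianReal 0 1 ∗ (c • Measure.dirac a)
      = c • gaussianReal a 1 := fun c a => by
    rw [Measure.conv_comm, Measure.conv_smul_left, Measure.conv_comm, hc]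
  rw [e, withDensity_add_left (hg1.const_smul _), withDensity_smul _ hg1, withDensity_smul _ hg2,
    ← gaussianReal_of_var_ne_zero _ one_ne_zero, ← gaussianReal_of_var_ne_zero _ one_ne_zero,
    skewMixture, skewCoin]
  have f1 : IsFiniteMeasure (ENNReal.ofReal (2 / 3) • Measure.dirac (-1 : ℝ)) :=
    Measure.smul_finite _ ENNReal.ofReal_ne_top
  have f2 : IsFiniteMeasure (ENNReal.ofReal (1 / 3) • Measure.dirac (2 : ℝ)) :=
    Measure.smul_finite _ ENNReal.ofReal_ne_top
  rw [Measure.conv_add, hs, hs]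

theorem isRegularDensity_skewDensity : IsRegularDensity skewMixture skewDensity where
  nonneg x := (skewDensity_pos x).le
  absCont _ _ := (contDiff_skewDensity (n := 1)).contDiffOn.absolutelyContinuousOnInterval
  eq_withDensity := skewMixture_eq_withDensity

theorem fisherInfo_skewMixture_lt_top : fisherInfo skewMixture < ∞ := by
  have hscore : ∀ x, |deriv skewDensity x / skewDensity x| ≤ |x| + 2 := fun x => by
    have h := ((hasDerivAt_gaussianPDFReal (-1) x).const_mul (2 / 3)).add
      ((hasDerivAt_gaussianPDFReal 2 x).const_mul (1 / 3))
    have hd : deriv skewDensity x = 2 / 3 * (-(x - -1) * gaussianPDFReal (-1) 1 x)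
        + 1 / 3 * (-(x - 2) * gaussianPDFReal 2 1 x) := h.deriv
    have h1 := gaussianPDFReal_pos (-1) 1 x one_ne_zero
    have h2 := gaussianPDFReal_pos 2 1 x one_ne_zero
    rw [abs_div, abs_of_pos (skewDensity_pos x), div_le_iff₀ (skewDensity_pos x), hd, skewDensity,
      abs_le]
    constructor <;> nlinarith [neg_abs_le x, le_abs_self x]
  have hi : Integrable (fun x : ℝ => (|x| + 2) ^ 2) skewMixture := by
    have h1 : MemLp id 2 skewMixture := memLp_id_skewMixture 2
    have h2 : MemLp (fun x : ℝ => |x| + 2) 2 skewMixture := h1.norm.add (memLp_const 2)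
    exact h2.integrable_sq
  refine (iInf₂_le skewDensity isRegularDensity_skewDensity).trans_lt
    (lt_of_le_of_lt (lintegral_mono fun x => ?_) hi.lintegral_lt_top)
  refine ENNReal.ofReal_le_ofReal (sq_le_sq.2 ((hscore x).trans (le_abs_self _)))

/-- The estimate reduces to `(|x - s| - 4)² ≥ 0`. -/
theorem gaussianPDFReal_ratio_le {m : ℝ} (hm : |m| ≤ 2) {x s : ℝ} (hs : s ∈ Set.uIoc 0 x) :
    gaussianPDFReal m 1 x ≤ Real.exp (2 * 4 - 2 * |x - s|) * gaussianPDFReal m 1 s := by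
  unfold gaussianPDFReal
  rw [mul_left_comm, ← Real.exp_add]
  refine mul_le_mul_of_nonneg_left (Real.exp_le_exp.2 ?_) (by positivity)
  rw [abs_le] at hm
  simp only [NNReal.coe_one, mul_one]
  rw [Set.mem_uIoc] at hs
  rcases hs with ⟨h0, h1⟩ | ⟨h0, h1⟩
  · rw [abs_of_nonneg (by linarith)]
    nlinarith [sq_nonneg (x - s - 4), mul_nonneg (sub_nonneg.2 h1) h0.le,
      mul_nonneg (sub_nonneg.2 h1) (sub_nonneg.2 hm.2)]
  · rw [abs_of_nonpos (by linarith)]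
    nlinarith [sq_nonneg (s - x - 4), mul_nonneg (sub_nonneg.2 h0.le) (neg_nonneg.2 h1),
      mul_nonneg (sub_nonneg.2 h0.le) (by linarith : 0 ≤ m + 2)]

theorem exists_poincareIneq_skewMixture : ∃ c, PoincareIneq skewMixture c := by
  refine exists_poincareIneq_of_density (a := 4) (memLp_id_skewMixture 2)
    (contDiff_skewDensity (n := 0)).continuous.measurable skewMixture_eq_withDensity
    fun x s hs => ?_
  have h1 := gaussianPDFReal_ratio_le (m := -1) (by norm_num) hs
  have h2 := gaussianPDFReal_ratio_le (m := 2) (by norm_num) hs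
  calc skewDensity x
      ≤ 2 / 3 * (Real.exp (2 * 4 - 2 * |x - s|) * gaussianPDFReal (-1) 1 s)
        + 1 / 3 * (Real.exp (2 * 4 - 2 * |x - s|) * gaussianPDFReal 2 1 s) := by
        unfold skewDensity
        gcongr
    _ = Real.exp (2 * 4 - 2 * |x - s|) * skewDensity s := by
        unfold skewDensity
        ring

theorem poincareConst_skewMixture_lt_top : poincareConst skewMixture < ∞ := by
  obtain ⟨c, hc⟩ := exists_poincareIneq_skewMixture
  exact (poincareConst_le_of_poincareIneq (memLp_id_skewMixture 2) hc).trans_lt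
    ENNReal.ofReal_lt_top

/-! ### Both bounds for normalized sums -/

theorem absolutelyContinuous_and_one_le_mul_variance {ν : Measure ℝ} [IsProbabilityMeasure ν] {J : ℝ≥0}
    (hν : MemLp id 2 ν) (h : fisherInfo ν < J) :
    ν ≪ volume ∧ 1 ≤ 32 * ((J : ℝ) + 2) ^ 2 * Var[id; ν] := by
  obtain ⟨p, hp, hlt⟩ := exists_isRegularDensity_of_fisherInfo_lt h
  refine ⟨hp.absolutelyContinuous, hp.one_le_mul_variance hν (by positivity)
    (hp.le_of_lintegral_score_sq_le J.coe_nonneg ?_)⟩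
  rw [ENNReal.ofReal_coe_nnreal]
  exact hlt.le

/-- The upper bound, in terms of laws. -/
theorem exists_poincareConst_normalized_le (I R : ℝ≥0) :
    ∃ C : ℝ, 0 ≤ C ∧ ∀ (ν : Measure ℝ) [IsProbabilityMeasure ν], fisherInfo ν = I →
      poincareConst ν = R → 0 < Var[id; ν] ∧ ∀ n : ℕ, 1 ≤ n →
        poincareConst ((convPow ν n).map (fun x => x / √(n * Var[id; ν])))
          ≤ ENNReal.ofReal (1 + C / n) := by
  set D : ℝ := 32 * (((I + 1 : ℝ≥0) : ℝ) + 2) ^ 2 with hD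
  have hD0 : 0 < D := by positivity
  obtain ⟨C, hC⟩ := exists_poincareIneq_convPow (ρ := R * D + 1) (by positivity)
  refine ⟨max C 0, le_max_right _ _, fun ν _ hI hR => ?_⟩
  have hRle : poincareConst ν ≤ ENNReal.ofReal R := by
    rw [hR, ENNReal.ofReal_coe_nnreal]
  have hν2 : MemLp id 2 ν := memLp_id_of_poincareConst_le hRle
  obtain ⟨hac, hvar⟩ := absolutelyContinuous_and_one_le_mul_variance (J := I + 1) hν2 (by
    rw [hI]
    exact_mod_cast lt_add_one I)
  rw [← hD] at hvar
  have hpos : 0 < Var[id; ν] := by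
    by_contra! hcon
    nlinarith
  refine ⟨hpos, fun n hn => ?_⟩
  have hP : PoincareIneq ν ((R * D + 1) * Var[id; ν]) := by
    refine (poincareIneq_of_poincareConst_le hac R.coe_nonneg hRle).mono ?_
    nlinarith [mul_le_mul_of_nonneg_left hvar R.coe_nonneg]
  have hn0 : (0 : ℝ) < n := by exact_mod_cast hn
  have hr : √(n * Var[id; ν]) ≠ 0 := (Real.sqrt_pos.2 (by positivity)).ne'
  have hPn := (hC ν hν2 hpos hP n).map_div hr
  have hm : Measurable (fun x : ℝ => x / √(n * Var[id; ν])) := measurable_id.div_const _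
  have : IsProbabilityMeasure ((convPow ν n).map (fun x => x / √(n * Var[id; ν]))) :=
    Measure.isProbabilityMeasure_map hm.aemeasurable
  have hmem : MemLp id 2 ((convPow ν n).map (fun x => x / √(n * Var[id; ν]))) := by
    rw [memLp_map_measure_iff aestronglyMeasurable_id hm.aemeasurable]
    have h1 : MemLp (fun x : ℝ => x) 2 (convPow ν n) := memLp_id_convPow hν2 n
    simp only [div_eq_mul_inv]
    exact h1.mul_const _
  refine (poincareConst_le_of_poincareIneq hmem hPn).trans (ENNReal.ofReal_le_ofReal ?_)
  rw [Real.sq_sqrt (by positivity), mul_div_mul_right _ _ hpos.ne', add_div, div_self hn0.ne']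
  gcongr
  exact le_max_left _ _

/-- The lower bound: a centred law with nonzero third moment keeps a third moment of order
`n^{-1/2}` after normalization. -/
theorem exists_le_poincareConst_normalized {ν : Measure ℝ} [IsProbabilityMeasure ν]
    (hν : MemLp id 4 ν) (h0 : ∫ x, x ∂ν = 0) (h3 : ∫ x, x ^ 3 ∂ν ≠ 0) (hpos : 0 < Var[id; ν]) :
    ∃ c : ℝ, 0 < c ∧ ∀ n : ℕ, 1 ≤ n →
      poincareConst ((convPow ν n).map (fun x => x / √(n * Var[id; ν]))) < ∞ →
      c / n ≤ (poincareConst ((convPow ν n).map (fun x => x / √(n * Var[id; ν])))).toReal - 1 := by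
  set v := Var[id; ν] with hv
  set μ₃ := ∫ x, x ^ 3 ∂ν with hμ₃
  set γ : ℝ := μ₃ ^ 2 / v ^ 3 with hγ
  have hγ0 : 0 < γ := by positivity
  refine ⟨(γ / 4) / (1 + γ / 4), by positivity, fun n hn hfin => ?_⟩
  have hn1 : (1 : ℝ) ≤ n := by exact_mod_cast hn
  have hn0 : (0 : ℝ) < n := by linarith
  set r := √(n * v) with hr
  have hr2 : r ^ 2 = n * v := Real.sq_sqrt (by positivity)
  have hr0 : 0 < r := Real.sqrt_pos.2 (by positivity)
  have hm : Measurable (fun x : ℝ => x / r) := measurable_id.div_const _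
  have hprob : IsProbabilityMeasure ((convPow ν n).map (fun x => x / r)) :=
    Measure.isProbabilityMeasure_map hm.aemeasurable
  have hmem : MemLp id 4 ((convPow ν n).map (fun x => x / r)) := by
    rw [memLp_map_measure_iff aestronglyMeasurable_id hm.aemeasurable]
    have h1 : MemLp (fun x : ℝ => x) 4 (convPow ν n) := memLp_id_convPow hν n
    simp only [div_eq_mul_inv]
    exact h1.mul_const _
  obtain ⟨hmean, hcube⟩ := integral_id_and_cube_convPow hν h0 n
  have e1 : ∫ x, x ∂((convPow ν n).map (fun x => x / r)) = 0 := by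
    rw [integral_map hm.aemeasurable (by fun_prop), integral_div, hmean, zero_div]
  have e2 : Var[id; (convPow ν n).map (fun x => x / r)] = 1 := by
    rw [variance_id_map hm.aemeasurable]
    simp only [div_eq_mul_inv]
    have h1 : Var[fun x : ℝ => x; convPow ν n] = n * v :=
      variance_id_convPow (hν.mono_exponent (by norm_num)) n
    rw [variance_mul_const, h1, ← hr2]
    field_simp
  have e3 : ∫ x, x ^ 3 ∂((convPow ν n).map (fun x => x / r)) = n * μ₃ / r ^ 3 := by
    rw [integral_map hm.aemeasurable (by fun_prop)]
    simp only [div_pow]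
    rw [integral_div, hcube]
  have h := le_poincareConst_of_third_moment hmem e1 e2 e3 hfin
  have e4 : (n * μ₃ / r ^ 3) ^ 2 = γ / n := by
    have h6 : (r ^ 3) ^ 2 = (n * v) ^ 3 := by rw [← hr2]; ring
    rw [div_pow, h6, hγ]
    field_simp
  rw [e4] at h
  refine le_trans ?_ h
  rw [div_div, div_le_div_iff₀ (by positivity) (by positivity)]
  have h7 : γ / n * n = γ := div_mul_cancel₀ _ hn0.ne'
  have h8 : γ / n ≤ γ := div_le_self hγ0.le hn1
  have h9 : γ / n / 4 * ((1 + γ / 4) * n) = γ / 4 * (1 + γ / 4) := by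
    field_simp
  rw [h9]
  gcongr

theorem theorem1p6 :
    -- the upper bound, with `C` depending on `I` and `R` only
    (∀ I R : ℝ≥0, ∃ C : ℝ, ∀ (Ω : Type*) [MeasurableSpace Ω] (P : Measure Ω)
      [IsProbabilityMeasure P] (X : ℕ → Ω → ℝ), IsIID P X →
        fisherInfo (P.map (X 0)) = I → poincareConst (P.map (X 0)) = R →
        ∀ n : ℕ, 1 ≤ n →
          poincareConst (P.map (normalizedSum P X n)) < ∞ ∧
          (poincareConst (P.map (normalizedSum P X n))).toReal - 1 ≤ C / n) ∧
    -- the rate `1 / n` is optimal up to the constant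
    (∃ (Ω : Type) (_ : MeasurableSpace Ω) (P : Measure Ω) (_ : IsProbabilityMeasure P)
      (X : ℕ → Ω → ℝ), IsIID P X ∧
        (∃ p : ℝ → ℝ, ContDiff ℝ (⊤ : ℕ∞) p ∧ IsRegularDensity (P.map (X 0)) p) ∧
        fisherInfo (P.map (X 0)) < ∞ ∧ poincareConst (P.map (X 0)) < ∞ ∧
        ∃ c : ℝ, 0 < c ∧ ∀ n : ℕ, 1 ≤ n →
          c / n ≤ (poincareConst (P.map (normalizedSum P X n))).toReal - 1) := by
  constructor
  · intro I R
    obtain ⟨C, hC0, hC⟩ := exists_poincareConst_normalized_le I R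
    refine ⟨C, fun Ω _ P _ X hX hI hR n hn => ?_⟩
    have : IsProbabilityMeasure (P.map (X 0)) :=
      Measure.isProbabilityMeasure_map (hX.measurable 0).aemeasurable
    have h := (hC (P.map (X 0)) hI hR).2 n hn
    rw [← hX.map_normalizedSum n] at h
    refine ⟨h.trans_lt ENNReal.ofReal_lt_top, ?_⟩
    have := ENNReal.toReal_le_of_le_ofReal (by positivity) h
    linarith
  · refine ⟨ℕ → ℝ, inferInstance, Measure.infinitePi fun _ => skewMixture, inferInstance,
      fun i ω => ω i, ?_⟩
    have hlaw : ∀ i : ℕ,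
        (Measure.infinitePi fun _ : ℕ => skewMixture).map (fun ω => ω i) = skewMixture :=
      fun i => Measure.infinitePi_map_eval _ i
    have hIID : IsIID (Measure.infinitePi fun _ : ℕ => skewMixture) (fun i ω => ω i) :=
      { measurable := fun i => measurable_pi_apply i
        indep := iIndepFun_infinitePi (X := fun _ x => x) fun _ => measurable_id
        identDistrib := fun i => ⟨(measurable_pi_apply i).aemeasurable,
          (measurable_pi_apply 0).aemeasurable, by rw [hlaw, hlaw]⟩ }
    obtain ⟨C, -, hC⟩ := exists_poincareConst_normalized_le (fisherInfo skewMixture).toNNReal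
      (poincareConst skewMixture).toNNReal
    obtain ⟨hpos, hfin⟩ := hC skewMixture
      (ENNReal.coe_toNNReal fisherInfo_skewMixture_lt_top.ne).symm
      (ENNReal.coe_toNNReal poincareConst_skewMixture_lt_top.ne).symm
    obtain ⟨c, hc0, hc⟩ := exists_le_poincareConst_normalized (memLp_id_skewMixture 4)
      integral_id_skewMixture (by rw [integral_cube_skewMixture]; norm_num) hpos
    refine ⟨hIID, ?_, ?_, ?_, c, hc0, fun n hn => ?_⟩
    · rw [hlaw]
      exact ⟨skewDensity, contDiff_skewDensity, isRegularDensity_skewDensity⟩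
    · rw [hlaw]
      exact fisherInfo_skewMixture_lt_top
    · rw [hlaw]
      exact poincareConst_skewMixture_lt_top
    · rw [hIID.map_normalizedSum n, hlaw]
      exact hc n hn ((hfin n hn).trans_lt ENNReal.ofReal_lt_top)
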